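/- All graphs are finite, simple and loopless. \textbf{Definitions.} A graph is \emph{distance hereditary} if the distance between any two vertices is the same in every connected induced subgraph containing them. For a graph $G$, $S\subseteq V(G)$ and $x\notin V(G)$, $G+(x,S)$ is $G$ augmented by a new vertex $x$ with neighbourhood $S$. A \emph{graph-labelled tree} $(T,\mathcal F)$ is a tree $T$ in which every node (internal vertex) $v$ is labelled by a graph $G_v\in\mathcal F$ together with a bijection $\rho_v$ from the tree-edges incident to $v$ to the vertices of $G_v$. Its \emph{accessibility graph} $G(T,\mathcal F)$ has the leaves of $T$ as vertices, two distinct leaves $x,y$ being adjacent iff for any two consecutive edges $e=wv$, $e'=vw'$ of the path from $x$ to $y$ in $T$ one has $\rho_v(e)\rho_v(e')\in E(G_v)$. A node $v$ is a \emph{clique node} if $G_v$ is complete, and a \emph{star node} if $G_v$ is a star $K_{1,n}$, the universal vertex being its \emph{centre} and the other vertices its \emph{extremities}. A \emph{split} of a graph is a bipartition $(V_1,V_2)$ of its vertex set with $|V_1|,|V_2|\ge 2$ such that every vertex of $N(V_1)$ is adjacent to every vertex of $N(V_2)$; a graph is \emph{prime} if it has no split. $(T,\mathcal F)$ is \emph{reduced}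 if every node has degree greater than $2$, no two clique nodes are adjacent, and no tree-edge between two star nodes is mapped to the centre of one star and to an extremity of the other. The \emph{split tree} $ST(G)$ of a connected graph $G$ is the unique (up to isomorphism) reduced graph-labelled tree with accessibility graph $G$ all of whose labels are prime graphs, cliques or stars. For a set $S$ of leaves of $T$, $T(S)$ is the smallest subtree of $T$ spanning the leaves of $S$. A node $u$ of $T(S)$ is \emph{fully accessible} if every maximal subtree of $T-u$ contains a leaf of $S$; \emph{singly accessible} if it is a star node and exactly two maximal subtrees of $T-u$ contain a leaf of $S$, one of them being the subtree attached to $u$ by the tree-edge mapped to the centre of $G_u$; and \emph{partially accessible} otherwise. A star node $v$ is \emph{oriented towards} a node $u\ne v$ (respectively a tree-edge $e$) if the tree-edge mapped to the centre of $G_v$ is on the path between $v$ and $u$ (respectively on the path between $v$ and $e$, the edge $e$ being counted as part of this path). \textbf{Theorem (Vertex incremental characterization).} Let $G$ be a connected distance hereditary graph with split tree $ST(G)=(T,\mathcal F)$, let $S\subseteq V(G)$ with $|S|\ge 2$, and let $x\notin V(G)$. Then $G+(x,S)$ is distance hereditary if and only if: \begin{enumerate} \item at most one node of $T(S)$ is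 partially accessible; \item every clique node of $T(S)$ is either fully or partially accessible; \item if there is a partially accessible node $u$, then every star node $v\neq u$ of $T(S)$ is oriented towards $u$ if and only if it is fully accessible; otherwise, there is a tree-edge $e$ of $T(S)$ such that every star node of $T(S)$ is oriented towards $e$ if and only if it is fully accessible. \end{enumerate} -/

import Mathlib

/-! ## Distance hereditary graphs and vertex addition -/

/-- A graph is distance hereditary if the distance between any two vertices is unchanged in every
connected induced subgraph containing them. -/
def IsDistanceHereditary {V : Type*} (G : SimpleGraph V) : Prop :=
  ∀ X : Set V, (G.induce X).Connected →
    ∀ a b : X, (G.induce X).dist a b = G.dist (a : V) (b : V)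

/-- The graph `G + (x, S)`: `G` augmented by a new vertex `x` (here `none`) whose neighbourhood
is `S`. -/
def addVertex {V : Type*} (G : SimpleGraph V) (S : Set V) : SimpleGraph (Option V) where
  Adj a b :=
    match a, b with
    | some a, some b => G.Adj a b
    | some a, none => a ∈ S
    | none, some b => b ∈ S
    | none, none => False
  symm := ⟨by
    rintro (_ | a) (_ | b) h
    · exact h
    · exact h
    · exact h
    · exact SimpleGraph.Adj.symm h⟩
  loopless := ⟨by
    rintro (_ | a) h
    · exact h
    · exact SimpleGraph.irrefl G h⟩

/-! ## Splits, prime and degenerate graphs -/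

/-- The neighbourhood `N(A)` of a set `A` of vertices. -/
def setNeighborhood {W : Type*} (H : SimpleGraph W) (A : Set W) : Set W :=
  {x | x ∉ A ∧ ∃ y ∈ A, H.Adj x y}

/-- `(A, B)` is a split of `H`: a bipartition of the vertex set into two parts of size at least
two such that every vertex of `N(A)` is adjacent to every vertex of `N(B)`. -/
def IsSplit {W : Type*} (H : SimpleGraph W) (A B : Set W) : Prop :=
  IsCompl A B ∧ A.Nontrivial ∧ B.Nontrivial ∧
    ∀ a ∈ setNeighborhood H A, ∀ b ∈ setNeighborhood H B, H.Adj a b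

/-- A graph is prime (for the split decomposition) if it has no split. -/
def IsPrimeGraph {W : Type*} (H : SimpleGraph W) : Prop :=
  ¬ ∃ A B : Set W, IsSplit H A B

/-- A clique is a complete graph. -/
def IsCliqueGraph {W : Type*} (H : SimpleGraph W) : Prop :=
  ∀ a b : W, a ≠ b → H.Adj a b

/-- `H` is a star `K_{1,n}` whose centre is `c`. -/
def IsStarWithCentre {W : Type*} (H : SimpleGraph W) (c : W) : Prop :=
  ∀ a b : W, H.Adj a b ↔ a ≠ b ∧ (a = c ∨ b = c)

/-- The graphs that are degenerate for the split decomposition: cliques and stars. -/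
def IsDegenerateGraph {W : Type*} (H : SimpleGraph W) : Prop :=
  IsCliqueGraph H ∨ ∃ c : W, IsStarWithCentre H c

/-! ## Graph-labelled trees -/

/-- A graph-labelled tree with tree-vertex set `N`. The marker vertices of the label of `v` are
indexed by the tree-edges incident to `v`, an edge `vw` being recorded by the neighbour `w` of `v`;
so the marker vertex that corresponds to `vw` is `⟨w, _⟩`. Only the labels of the nodes (internal
vertices) are meaningful; labels of leaves are never used. -/
structure GraphLabelledTree (N : Type*) where
  tree : SimpleGraph N
  isTree : tree.IsTree
  label : ∀ v : N, SimpleGraph (tree.neighborSet v)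

namespace GraphLabelledTree

variable {N : Type*} (T : GraphLabelledTree N)

/-- A leaf is a tree-vertex with at most one neighbour (the vertex of a one-vertex tree is a
leaf). -/
def IsLeaf (v : N) : Prop := (T.tree.neighborSet v).Subsingleton

/-- A node is an internal vertex of the tree. -/
def IsNode (v : N) : Prop := ¬ T.IsLeaf v

/-- `u` is `l`-accessible: for any two distinct tree-edges `wv`, `vw'` on the path from `l` to `u`,
the corresponding marker vertices are adjacent in the label of `v`. -/
def Accessible (l u : N) : Prop :=
  l ≠ u ∧ ∀ p : T.tree.Walk l u, p.IsPath →
    ∀ (v : N) (w w' : T.tree.neighborSet v), w ≠ w' →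
      s((w : N), v) ∈ p.edges → s(v, (w' : N)) ∈ p.edges → (T.label v).Adj w w'

/-- The accessibility graph: its vertices are the leaves of the tree, and `x`, `y` are adjacent iff
`y` is `x`-accessible. -/
def accessibilityGraph : SimpleGraph {l : N // T.IsLeaf l} where
  Adj x y := T.Accessible x y
  symm := ⟨by
    rintro x y ⟨hne, h⟩
    refine ⟨hne.symm, fun p hp v w w' hw h1 h2 => h p.reverse hp.reverse v w w' hw ?_ ?_⟩
    · simpa using h1
    · simpa using h2⟩
  loopless := ⟨fun _ h => h.1 rfl⟩

/-- `v` is a clique node. -/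
def IsCliqueNode (v : N) : Prop := T.IsNode v ∧ IsCliqueGraph (T.label v)

/-- `v` is a star node, and the tree-edge `vc` is mapped to the centre of the star. -/
def IsStarNode (v : N) (c : T.tree.neighborSet v) : Prop :=
  T.IsNode v ∧ IsStarWithCentre (T.label v) c

/-- A clique-join can be applied to the tree-edge `uv`: both extremities are clique nodes. -/
def CliqueJoinable (u v : N) : Prop :=
  T.tree.Adj u v ∧ T.IsCliqueNode u ∧ T.IsCliqueNode v

/-- A star-join can be applied to the tree-edge `uv`: `u` and `v` are star nodes, and `uv` links the
centre of the star at `u` to an extremity of the star at `v`. -/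
def StarJoinable (u v : N) : Prop :=
  ∃ (c : T.tree.neighborSet u) (d : T.tree.neighborSet v), T.tree.Adj u v ∧
    T.IsStarNode u c ∧ T.IsStarNode v d ∧ (c : N) = v ∧ (d : N) ≠ u

/-- A graph-labelled tree is reduced if every node has degree greater than two and neither a
clique-join nor a star-join can be applied. -/
def IsReduced : Prop :=
  (∀ v, T.IsNode v → 2 < (T.tree.neighborSet v).ncard) ∧
  (∀ u v, ¬ T.CliqueJoinable u v) ∧
  (∀ u v, ¬ T.StarJoinable u v)

/-- The vertex set of `T(S)`, the smallest subtree of `T` spanning the set `S`: the union of the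
paths between elements of `S`. The tree-edges of `T(S)` are the edges of `T` joining two of these
vertices. -/
def span (S : Set N) : Set N :=
  {v | ∃ a ∈ S, ∃ b ∈ S, ∃ p : T.tree.Walk a b, p.IsPath ∧ v ∈ p.support}

/-- `u` is a node of `T(S)`. -/
def IsNodeOfSpan (S : Set N) (u : N) : Prop := T.IsNode u ∧ u ∈ T.span S

/-- The maximal subtree of `T - u` that contains the vertex `w ≠ u` (its connected component). -/
def branch (u w : N) : Set N := {z | ∃ p : T.tree.Walk w z, u ∉ p.support}

/-- The neighbours `w` of `u` such that the subtree of `T - u` containing `w` contains an element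
of `S`; the subtrees of `T - u` correspond one to one to the neighbours of `u`. -/
def hitNeighbors (S : Set N) (u : N) : Set N :=
  {w | T.tree.Adj u w ∧ ∃ l ∈ S, l ∈ T.branch u w}

/-- `u` is fully accessible: every subtree of `T - u` contains an element of `S`. -/
def FullyAccessible (S : Set N) (u : N) : Prop :=
  T.IsNodeOfSpan S u ∧ ∀ w, T.tree.Adj u w → w ∈ T.hitNeighbors S u

/-- `u` is singly accessible: it is a star node and exactly two subtrees of `T - u` contain an
element of `S`, among which the one attached to the centre of the star. -/
def SinglyAccessible (S : Set N) (u : N) : Prop :=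
  T.IsNodeOfSpan S u ∧ ∃ c : T.tree.neighborSet u, T.IsStarNode u c ∧
    (T.hitNeighbors S u).ncard = 2 ∧ (c : N) ∈ T.hitNeighbors S u

/-- `u` is partially accessible: it is a node of `T(S)` that is neither fully nor singly
accessible. -/
def PartiallyAccessible (S : Set N) (u : N) : Prop :=
  T.IsNodeOfSpan S u ∧ ¬ T.FullyAccessible S u ∧ ¬ T.SinglyAccessible S u

/-- The star at `v`, whose centre is mapped to the tree-edge `vc`, is oriented towards the
tree-vertex `u`: the tree-edge `vc` is on the path between `u` and `v`. -/
def OrientedTowards (v c u : N) : Prop :=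
  ∃ p : T.tree.Walk v u, p.IsPath ∧ s(v, c) ∈ p.edges

/-- The star at `v`, whose centre is mapped to the tree-edge `vc`, is oriented towards the
tree-edge `ab`: the tree-edge `vc` is on the path between `ab` and `v`. That path contains `ab`
itself, so it is the path from `v` to the extremity of `ab` that is further from `v`. -/
def OrientedTowardsEdge (v c a b : N) : Prop :=
  T.OrientedTowards v c a ∨ T.OrientedTowards v c b

end GraphLabelledTree

/-- The split tree `ST(G)`, with tree-vertex set `N`: a reduced graph-labelled tree all of whose
nodes are labelled by prime or degenerate graphs, and whose accessibility graph is `G`; `leaf`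
identifies the vertices of `G` with the leaves of the tree. -/
structure SplitTree {V : Type*} (G : SimpleGraph V) (N : Type*) extends GraphLabelledTree N where
  leaf : G ≃g toGraphLabelledTree.accessibilityGraph
  reduced : toGraphLabelledTree.IsReduced
  prime_or_degenerate : ∀ v, toGraphLabelledTree.IsNode v →
    IsPrimeGraph (label v) ∨ IsDegenerateGraph (label v)

/-- The set of leaves of the split tree that corresponds to a set `S` of vertices of `G`. -/
def SplitTree.leaves {V : Type*} {G : SimpleGraph V} {N : Type*} (ST : SplitTree G N)
    (S : Set V) : Set N :=
  (fun x => (ST.leaf x : N)) '' S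

/-!
Let `H = G + (x, S)`. A branch at a tree-vertex `u`, with leaf set `W`, is *good* if `S ∩ W` is
empty or is the set of all leaves of `W` accessible from `u`; this says that `(W, V(H) \ W)` is
still a split (possibly trivial) of `H`. The theorem is obtained from the equivalence of three
conditions: `H` is distance hereditary; all branches at some tree-vertex `u` are good (so that the
new leaf can be attached at `u`); the accessibility conditions of the theorem hold.

Distance hereditary graphs enter only through *shortcuts*: a graph is distance hereditary if and
only if, whenever `a` and `b` have a common neighbour `e`, each walk from `a` to `b` has among its
own vertices a path of length at most two from `a` to `b` (`HasShortcuts`). A graph without this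
property has an *obstruction*: an induced path of length at least three together with a common
neighbour of its ends. An obstruction is prime (`IsObstruction.false_of_cut`). Conversely, a
connected graph with shortcuts on at least four vertices has a split
(`HasShortcuts.exists_split`). Each label of the split tree embeds in `G`, so it has shortcuts,
and therefore is a clique or a star.

If `H` is distance hereditary, then for each tree-edge at least one of its two branches is good
(`SplitTree.isGood_or_isGood`). This is where reducedness enters: the types of the two labels at
the edge exclude the non-canonical splits of cliques and stars, and in each remaining case two bad
branches give one of the forbidden house, gem or domino, or two elements of `S` that are too far
apart in `G`. Choosing a tree-edge with a good branch on one side and the other side minimal gives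
a node at which all branches are good and of which at least two meet `S`
(`SplitTree.exists_forall_isGood`).

If all branches at `u` are good, an obstruction in `H` contains `x`, and by primality it meets
each branch in at most one vertex, or has only `x` outside some branch. In the second case `x` can
be replaced by a vertex of `G`; in the first case the obstruction minus `x` is a graph read off
from the label of `u`, which is a clique or a star, and this is absurd
(`SplitTree.addVertex_hasShortcuts_of_forall_isGood`).

Finally, if all branches at a node `u` of `T(S)` are good, then at any other node `v` of `T(S)`
the branches that meet `S` are the one towards `u` and those whose marker is adjacent to it in the
label of `v` (`SplitTree.mem_hitNeighbors_iff_of_forall_isGood`), from which the accessibility of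
`v` is read off. Conversely, the accessibility conditions at the nodes of a branch force it to be
good, by induction on the branch (`SplitTree.inter_side_eq_frontier`).
-/

open SimpleGraph

/-! ### Distance hereditary graphs and shortcuts -/

/-- A graph has shortcuts if, whenever `a` and `b` have a common neighbour, each walk from `a` to
`b` contains the vertices of a walk of length at most two between them. This is the case "distance
at most two" of distance heredity. -/
def HasShortcuts {V : Type*} (G : SimpleGraph V) : Prop :=
  ∀ (a b e : V) (p : G.Walk a b), G.Adj e a → G.Adj e b →
    a = b ∨ G.Adj a b ∨ ∃ c ∈ p.support, G.Adj a c ∧ G.Adj c b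

theorem IsDistanceHereditary.hasShortcuts {V : Type*} {G : SimpleGraph V}
    (h : IsDistanceHereditary G) : HasShortcuts G := by
  intro a b e p ha hb
  have hc := p.connected_induce_support
  have h2 : (G.induce {v | v ∈ p.support}).dist ⟨a, p.start_mem_support⟩ ⟨b, p.end_mem_support⟩
      ≤ 2 := by
    rw [h _ hc]
    exact dist_le (Walk.cons ha.symm (Walk.cons hb Walk.nil))
  obtain ⟨w, hw⟩ := hc.exists_walk_length_eq_dist ⟨a, p.start_mem_support⟩ ⟨b, p.end_mem_support⟩
  rw [← hw] at h2
  match w, h2 with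
  | .nil, _ => exact Or.inl rfl
  | .cons h .nil, _ => exact Or.inr (Or.inl h)
  | .cons (v := c) h (.cons h' .nil), _ => exact Or.inr (Or.inr ⟨c, c.2, h, h'⟩)
  | .cons _ (.cons _ (.cons _ _)), h2 => simp at h2

/-- Distances are preserved in the vertex set of a walk `p`. Induction on a walk `r` in the whole
graph: its second vertex `q` is added to `p`; if the shortened walk from `q` leaves `q` to `c`,
then `a` and `c` have the common neighbour `q`, and the shortcut between them replaces `q`. -/
theorem HasShortcuts.exists_walk_length_le {V : Type*} {G : SimpleGraph V} (h : HasShortcuts G)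
    {a b : V} (r : G.Walk a b) : ∀ p : G.Walk a b,
      ∃ p' : G.Walk a b, p'.length ≤ r.length ∧ p'.support ⊆ p.support := by
  classical
  induction r with
  | nil => exact fun p => ⟨.nil, le_rfl, by simp⟩
  | @cons a q b haq r ih =>
    intro p
    obtain ⟨p₁, hl, hs⟩ := ih (.cons haq.symm p)
    by_cases hq : q ∈ p.support
    · refine ⟨.cons haq p₁, by simpa using hl, ?_⟩
      intro z hz
      simp only [Walk.support_cons, List.mem_cons] at hz
      rcases hz with rfl | hz
      · simp
      · rcases List.mem_cons.1 (by simpa using hs hz) with rfl | h'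
        · exact hq
        · exact h'
    · have hb' := p₁.length_bypass_le_length
      have hs' := p₁.support_bypass_subset_support
      have hp' := p₁.bypass_isPath
      revert hb' hs' hp'
      generalize p₁.bypass = p₂
      intro hb' hs' hp'
      cases p₂ with
      | nil => exact absurd p.end_mem_support hq
      | @cons _ c _ hqc p₃ =>
        rw [Walk.cons_isPath_iff] at hp'
        have hs3 : p₃.support ⊆ p.support := by
          intro z hz
          have := hs (hs' (by simp [hz] : z ∈ (Walk.cons hqc p₃).support))
          simp only [Walk.support_cons, List.mem_cons] at this
          rcases this with rfl | h'
          · exact absurd hz hp'.2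
          · exact h'
        have hc : c ∈ p.support := hs3 p₃.start_mem_support
        simp only [Walk.length_cons] at hb' ⊢
        rcases h a c q (p.takeUntil c hc) haq.symm hqc with rfl | hac | ⟨d, hd, had, hdc⟩
        · exact ⟨p₃, by omega, hs3⟩
        · refine ⟨.cons hac p₃, by simp; omega, ?_⟩
          simpa using hs3
        · refine ⟨.cons had (.cons hdc p₃), by simp; omega, ?_⟩
          simpa using ⟨p.support_takeUntil_subset_support hc hd, hs3⟩

theorem HasShortcuts.isDistanceHereditary {V : Type*} {G : SimpleGraph V} (h : HasShortcuts G) :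
    IsDistanceHereditary G := by
  intro X hX a b
  obtain ⟨p⟩ := hX.preconnected a b
  have hP : G.Reachable (a : V) b := ⟨p.map (Embedding.induce X).toHom⟩
  obtain ⟨r, hr⟩ := hP.exists_walk_length_eq_dist
  obtain ⟨w, hw⟩ := hX.exists_walk_length_eq_dist a b
  apply le_antisymm
  · obtain ⟨p', hl, hs⟩ := h.exists_walk_length_le r (p.map (Embedding.induce X).toHom)
    rw [← hr]
    refine le_trans ?_ hl
    have hX' : ∀ z ∈ p'.support, z ∈ X := by
      intro z hz
      have := List.mem_map.1 ((congrArg (z ∈ ·) (Walk.support_map _ _)).mp (hs hz))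
      obtain ⟨y, -, rfl⟩ := this
      exact y.2
    have := dist_le (p'.induce X hX')
    refine this.trans (le_of_eq ?_)
    have h2 := congrArg Walk.length (Walk.map_induce p' hX')
    rwa [Walk.length_map] at h2
  · rw [← hw, ← Walk.length_map (Embedding.induce X).toHom w]
    exact dist_le _

/-! ### Obstructions and their primality -/

/-- An obstruction to distance heredity: an induced path `q 0, …, q k` of length `k ≥ 3` and a
common neighbour `e` of its ends. The values of `q` beyond `k` are irrelevant, and `e` may have
further neighbours on the path. -/
structure IsObstruction {V : Type*} (G : SimpleGraph V) (k : ℕ) (q : ℕ → V) (e : V) : Prop where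
  three_le : 3 ≤ k
  adj_iff : ∀ i ≤ k, ∀ j ≤ k, (G.Adj (q i) (q j) ↔ j = i + 1 ∨ i = j + 1)
  adj_first : G.Adj e (q 0)
  adj_last : G.Adj e (q k)

/-- The induced path is a shortest walk inside the vertex set of a walk that has no shortcut. -/
theorem exists_isObstruction {V : Type*} {G : SimpleGraph V} (h : ¬ HasShortcuts G) :
    ∃ k q e, IsObstruction G k q e := by
  classical
  simp only [HasShortcuts, not_forall, not_or, not_exists, not_and] at h
  obtain ⟨a, b, e, p, ha, hb, hab, hnab, hc⟩ := h
  have hconn := p.connected_induce_support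
  obtain ⟨w, hw⟩ := hconn.exists_walk_length_eq_dist ⟨a, p.start_mem_support⟩
    ⟨b, p.end_mem_support⟩
  have key : ∀ i j, i ≤ j → j ≤ w.length → (G.Adj (w.getVert i) (w.getVert j) → j ≤ i + 1) := by
    intro i j hij hj hadj
    have hadj' : (G.induce {v | v ∈ p.support}).Adj (w.getVert i) (w.getVert j) := hadj
    have := dist_le (((w.take i).concat hadj').append (w.drop j))
    rw [← hw] at this
    simp only [Walk.length_append, Walk.length_concat, Walk.take_length, Walk.drop_length] at this
    omega
  have h3 : 3 ≤ w.length := by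
    match w with
    | .nil => exact absurd rfl hab
    | .cons h .nil => exact absurd h hnab
    | .cons (v := c) h (.cons h' .nil) => exact absurd h' (hc c c.2 h)
    | .cons _ (.cons _ (.cons _ _)) => simp
  refine ⟨w.length, fun i => w.getVert i, e, h3, fun i hi j hj => ⟨fun hadj => ?_, ?_⟩, ?_, ?_⟩
  · have hne : i ≠ j := fun h => by subst h; exact G.irrefl hadj
    rcases lt_or_gt_of_ne hne with h | h
    · have := key i j h.le hj hadj
      omega
    · have := key j i h.le hi hadj.symm
      omega
  · rintro (rfl | rfl)
    · exact w.adj_getVert_succ (by omega)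
    · exact (w.adj_getVert_succ (by omega) :
        (G.induce {v | v ∈ p.support}).Adj (w.getVert j) (w.getVert (j + 1))).symm
  · simpa using ha
  · simpa using hb

theorem IsObstruction.not_hasShortcuts {V : Type*} {G : SimpleGraph V} {k : ℕ} {q : ℕ → V} {e : V}
    (ho : IsObstruction G k q e) : ¬ HasShortcuts G := by
  intro h
  have hk := ho.three_le
  have key : ∀ m ≤ k, ∃ p : G.Walk (q 0) (q m), ∀ c ∈ p.support, ∃ i ≤ k, c = q i := by
    intro m
    induction m with
    | zero => exact fun _ => ⟨.nil, fun c hc => ⟨0, by omega, by simpa using hc⟩⟩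
    | succ m ih =>
      intro hm
      obtain ⟨p, hp⟩ := ih (by omega)
      refine ⟨p.concat ((ho.adj_iff m (by omega) (m + 1) hm).2 (Or.inl rfl)), fun c hc => ?_⟩
      rw [Walk.support_concat] at hc
      rcases (by simpa using hc) with hc | rfl
      · exact hp c hc
      · exact ⟨m + 1, hm, rfl⟩
  obtain ⟨p, hp⟩ := key k le_rfl
  rcases h _ _ _ p ho.adj_first ho.adj_last with h | h | ⟨c, hc, h1, h2⟩
  · have h1 := (ho.adj_iff 0 (by omega) 1 (by omega)).2 (Or.inl rfl)
    rw [h, ho.adj_iff k le_rfl 1 (by omega)] at h1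
    omega
  · rw [ho.adj_iff 0 (by omega) k le_rfl] at h
    omega
  · obtain ⟨i, hi, rfl⟩ := hp c hc
    rw [ho.adj_iff 0 (by omega) i hi] at h1
    rw [ho.adj_iff i hi k le_rfl] at h2
    omega

/-- A predicate that holds at `i` and fails at `j ≥ i` changes between two consecutive numbers. -/
theorem exists_crossing {P : ℕ → Prop} {i j : ℕ} (hij : i ≤ j) (hi : P i) (hj : ¬ P j) :
    ∃ m, i ≤ m ∧ m < j ∧ P m ∧ ¬ P (m + 1) := by
  by_contra! h
  have : ∀ d, i + d ≤ j → P (i + d) := by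
    intro d
    induction d with
    | zero => exact fun _ => hi
    | succ d ih =>
      intro hd
      exact h (i + d) (by omega) (by omega) (ih (by omega))
  obtain ⟨d, rfl⟩ := Nat.exists_eq_add_of_le hij
  exact hj (this d le_rfl)

theorem IsObstruction.injOn {V : Type*} {G : SimpleGraph V} {k : ℕ} {q : ℕ → V} {e : V}
    (ho : IsObstruction G k q e) {i j : ℕ} (hi : i ≤ k) (hj : j ≤ k) (h : q i = q j) : i = j := by
  have h3 := ho.three_le
  wlog hij : i ≤ j generalizing i j
  · exact (this hj hi h.symm (by omega)).symm
  by_contra hne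
  rcases Nat.eq_zero_or_pos i with rfl | hpos
  · have h1 := (ho.adj_iff 0 (by omega) 1 (by omega)).2 (Or.inl rfl)
    rw [h, ho.adj_iff _ hj 1 (by omega)] at h1
    have h1 := (ho.adj_iff j hj 3 (by omega))
    rw [← h, ho.adj_iff _ hi 3 (by omega)] at h1
    omega
  · have h1 := (ho.adj_iff (i - 1) (by omega) i (by omega)).2 (Or.inl (by omega))
    rw [h, ho.adj_iff _ (by omega) j (by omega)] at h1
    omega

/-- Primality of an obstruction, for the side `W` that contains the apex `e`. Each end in `W` of a
crossing edge is adjacent to each end outside `W` of a crossing edge. The induced path is too long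
for this, wherever its two ends lie. -/
theorem IsObstruction.false_of_cut_of_mem {V : Type*} {G : SimpleGraph V} {k : ℕ} {q : ℕ → V}
    {e : V} (ho : IsObstruction G k q e) {W : Set V} {α β : V → Prop}
    (hcut : ∀ a ∈ W, ∀ b ∉ W, (G.Adj a b ↔ α a ∧ β b)) (he : e ∈ W)
    {a : ℕ} (ha : a ≤ k) (haW : q a ∈ W) {i j : ℕ} (hij : i < j) (hj : j ≤ k)
    (hiW : q i ∉ W) (hjW : q j ∉ W) : False := by
  have h3 := ho.three_le
  have hadj : ∀ m < k, G.Adj (q m) (q (m + 1)) := fun m hm =>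
    (ho.adj_iff m hm.le (m + 1) hm).2 (Or.inl rfl)
  by_cases h0 : q 0 ∈ W <;> by_cases hk : q k ∈ W
  · obtain ⟨m, -, hm, hmW, hmW'⟩ := exists_crossing (P := fun n => q n ∈ W) (Nat.zero_le i) h0 hiW
    obtain ⟨n, hn, hnk, hnW, hnW'⟩ := exists_crossing (P := fun n => q n ∉ W) hj hjW (by simpa)
    have e1 := (hcut _ hmW _ hmW').1 (hadj m (by omega))
    have e2 := (hcut _ (not_not.1 hnW') _ hnW).1 (hadj n (by omega)).symm
    have := (hcut _ hmW _ hnW).2 ⟨e1.1, e2.2⟩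
    rw [ho.adj_iff _ (by omega) _ (by omega)] at this
    omega
  · obtain ⟨m, -, hm, hmW, hmW'⟩ := exists_crossing (P := fun n => q n ∈ W) (Nat.zero_le i) h0 hiW
    have e1 := (hcut _ hmW _ hmW').1 (hadj m (by omega))
    have e2 := (hcut _ he _ hk).1 ho.adj_last
    have := (hcut _ hmW _ hk).2 ⟨e1.1, e2.2⟩
    rw [ho.adj_iff _ (by omega) _ (by omega)] at this
    omega
  · obtain ⟨n, hn, hnk, hnW, hnW'⟩ := exists_crossing (P := fun n => q n ∉ W) hj hjW (by simpa)
    have e1 := (hcut _ (not_not.1 hnW') _ hnW).1 (hadj n (by omega)).symm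
    have e2 := (hcut _ he _ h0).1 ho.adj_first
    have := (hcut _ (not_not.1 hnW') _ h0).2 ⟨e1.1, e2.2⟩
    rw [ho.adj_iff _ (by omega) _ (by omega)] at this
    omega
  · obtain ⟨n, hn, hnk, hnW, hnW'⟩ := exists_crossing (P := fun n => q n ∉ W) (Nat.zero_le a) h0
      (by simpa)
    have e1 := (hcut _ (not_not.1 hnW') _ hnW).1 (hadj n (by omega)).symm
    have e2 := (hcut _ he _ h0).1 ho.adj_first
    have e3 := (hcut _ he _ hk).1 ho.adj_last
    have t1 := (hcut _ (not_not.1 hnW') _ h0).2 ⟨e1.1, e2.2⟩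
    have t2 := (hcut _ (not_not.1 hnW') _ hk).2 ⟨e1.1, e3.2⟩
    rw [ho.adj_iff _ (by omega) _ (by omega)] at t1 t2
    omega

/-- The vertex set of an obstruction. -/
def obstructionVerts {V : Type*} (k : ℕ) (q : ℕ → V) (e : V) : Set V :=
  {y | y = e ∨ ∃ i ≤ k, y = q i}

/-- An obstruction is prime: a cut whose crossing edges form a complete bipartite graph has at
most one vertex of the obstruction on one of its sides. The predicates `α` and `β` describe the
two parts of the complete bipartite graph. -/
theorem IsObstruction.false_of_cut {V : Type*} {G : SimpleGraph V} {k : ℕ} {q : ℕ → V}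
    {e : V} (ho : IsObstruction G k q e) {W : Set V} {α β : V → Prop}
    (hcut : ∀ a ∈ W, ∀ b ∉ W, (G.Adj a b ↔ α a ∧ β b))
    (h1 : (obstructionVerts k q e ∩ W).Nontrivial)
    (h2 : (obstructionVerts k q e \ W).Nontrivial) : False := by
  have aux : ∀ (W : Set V) (α β : V → Prop),
      (∀ a ∈ W, ∀ b ∉ W, (G.Adj a b ↔ α a ∧ β b)) → e ∈ W →
      (obstructionVerts k q e ∩ W).Nontrivial → (obstructionVerts k q e \ W).Nontrivial →
      False := by
    intro W α β hcut he h1 h2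
    obtain ⟨x, ⟨hx, hxW⟩, hxe⟩ := h1.exists_ne e
    obtain ⟨y, ⟨hy, hyW⟩, z, ⟨hz, hzW⟩, hyz⟩ := h2
    obtain ⟨a, ha, rfl⟩ := hx.resolve_left hxe
    obtain ⟨i, hi, rfl⟩ := hy.resolve_left (fun h => hyW (h ▸ he))
    obtain ⟨j, hj, rfl⟩ := hz.resolve_left (fun h => hzW (h ▸ he))
    have hij : i ≠ j := fun h => hyz (h ▸ rfl)
    rcases lt_or_gt_of_ne hij with h | h
    · exact ho.false_of_cut_of_mem hcut he ha hxW h hj hyW hzW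
    · exact ho.false_of_cut_of_mem hcut he ha hxW h hi hzW hyW
  by_cases he : e ∈ W
  · exact aux W α β hcut he h1 h2
  · refine aux Wᶜ β α (fun a ha b hb => ?_) he h2 (by simpa [Set.sdiff_eq] using h1)
    rw [G.adj_comm, hcut b (by simpa using hb) a ha, and_comm]

section Obstruction

variable {V V' : Type*} {G : SimpleGraph V} {G' : SimpleGraph V'} {k : ℕ} {q : ℕ → V} {e : V}

theorem mem_obstructionVerts_apex : e ∈ obstructionVerts k q e := Or.inl rfl

theorem mem_obstructionVerts_path {i : ℕ} (hi : i ≤ k) : q i ∈ obstructionVerts k q e :=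
  Or.inr ⟨i, hi, rfl⟩

theorem IsObstruction.map (ho : IsObstruction G k q e) (φ : V → V')
    (h : ∀ a ∈ obstructionVerts k q e, ∀ b ∈ obstructionVerts k q e,
      (G.Adj a b ↔ G'.Adj (φ a) (φ b))) : IsObstruction G' k (fun i => φ (q i)) (φ e) where
  three_le := ho.three_le
  adj_iff i hi j hj := by
    rw [← ho.adj_iff i hi j hj,
      h _ (mem_obstructionVerts_path hi) _ (mem_obstructionVerts_path hj)]
  adj_first := (h _ mem_obstructionVerts_apex _ (mem_obstructionVerts_path (Nat.zero_le k))).1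
    ho.adj_first
  adj_last := (h _ mem_obstructionVerts_apex _ (mem_obstructionVerts_path le_rfl)).1 ho.adj_last

theorem IsObstruction.adj_succ (ho : IsObstruction G k q e) {i : ℕ} (hi : i < k) :
    G.Adj (q i) (q (i + 1)) := (ho.adj_iff i hi.le (i + 1) hi).2 (Or.inl rfl)

theorem IsObstruction.exists_adj (ho : IsObstruction G k q e) {a : V}
    (ha : a ∈ obstructionVerts k q e) : ∃ b ∈ obstructionVerts k q e, G.Adj a b := by
  have h3 := ho.three_le
  rcases ha with rfl | ⟨i, hi, rfl⟩
  · exact ⟨_, mem_obstructionVerts_path (Nat.zero_le k), ho.adj_first⟩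
  · rcases Nat.lt_or_ge i k with h | h
    · exact ⟨_, mem_obstructionVerts_path (Nat.succ_le_of_lt h), ho.adj_succ h⟩
    · obtain rfl : i = k := le_antisymm hi h
      exact ⟨_, mem_obstructionVerts_apex, ho.adj_last.symm⟩

theorem IsObstruction.apex_ne (ho : IsObstruction G k q e) {i : ℕ} (hi : i ≤ k) : e ≠ q i := by
  rintro rfl
  have h3 := ho.three_le
  have h1 := ho.adj_first
  have h2 := ho.adj_last
  rw [ho.adj_iff i hi 0 (Nat.zero_le k)] at h1
  rw [ho.adj_iff i hi k le_rfl] at h2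
  omega

theorem IsObstruction.ne (ho : IsObstruction G k q e) {i j : ℕ} (hi : i ≤ k) (hj : j ≤ k)
    (h : i ≠ j) : q i ≠ q j := fun h' => h (ho.injOn hi hj h')

/-- An obstruction minus any vertex is not a disjoint union of cliques. -/
theorem IsObstruction.exists_path_three (ho : IsObstruction G k q e) (n : V) :
    ∃ x ∈ obstructionVerts k q e, ∃ y ∈ obstructionVerts k q e, ∃ z ∈ obstructionVerts k q e,
      x ≠ n ∧ y ≠ n ∧ z ≠ n ∧ x ≠ z ∧ G.Adj x y ∧ G.Adj y z ∧ ¬ G.Adj x z := by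
  have h3 := ho.three_le
  have hm := fun {i} (hi : i ≤ k) => mem_obstructionVerts_path (q := q) (e := e) hi
  have hne := fun {i j} (hi : i ≤ k) (hj : j ≤ k) (h : i ≠ j) => ho.ne hi hj h
  have hna : ∀ {i j}, i ≤ k → j ≤ k → i + 2 ≤ j → ¬ G.Adj (q i) (q j) := fun {i j} hi hj h h' => by
    rw [ho.adj_iff i hi j hj] at h'
    omega
  by_cases h0 : q 0 = n
  · subst h0
    exact ⟨q 1, hm (by omega), q 2, hm (by omega), q 3, hm h3, hne (by omega) (by omega) (by omega),
      hne (by omega) (by omega) (by omega), hne (by omega) (by omega) (by omega),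
      hne (by omega) (by omega) (by omega), ho.adj_succ (by omega), ho.adj_succ (by omega),
      hna (by omega) (by omega) (by omega)⟩
  have key : ∀ i, 1 ≤ i → i ≤ 2 → q i = n → ∃ x ∈ obstructionVerts k q e,
      ∃ y ∈ obstructionVerts k q e, ∃ z ∈ obstructionVerts k q e,
      x ≠ n ∧ y ≠ n ∧ z ≠ n ∧ x ≠ z ∧ G.Adj x y ∧ G.Adj y z ∧ ¬ G.Adj x z := by
    rintro i h1 h2 rfl
    exact ⟨q 0, hm (by omega), e, mem_obstructionVerts_apex, q k, hm le_rfl, h0,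
      ho.apex_ne (by omega), hne le_rfl (by omega) (by omega), hne (by omega) le_rfl (by omega),
      ho.adj_first.symm, ho.adj_last, hna (by omega) le_rfl (by omega)⟩
  by_cases h1 : q 1 = n
  · exact key 1 le_rfl (by omega) h1
  by_cases h2 : q 2 = n
  · exact key 2 (by omega) le_rfl h2
  exact ⟨q 0, hm (by omega), q 1, hm (by omega), q 2, hm (by omega), h0, h1, h2,
    hne (by omega) (by omega) (by omega), ho.adj_succ (by omega), ho.adj_succ (by omega),
      hna (by omega) (by omega) (by omega)⟩

/-- An obstruction minus any vertex has two disjoint edges: its vertices lie on a cycle of length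
at least five. -/
theorem IsObstruction.exists_two_edges (ho : IsObstruction G k q e) (n : V) :
    ∃ a ∈ obstructionVerts k q e, ∃ b ∈ obstructionVerts k q e, ∃ c ∈ obstructionVerts k q e,
      ∃ d ∈ obstructionVerts k q e, (a ≠ n ∧ b ≠ n ∧ c ≠ n ∧ d ≠ n) ∧
      (a ≠ c ∧ a ≠ d ∧ b ≠ c ∧ b ≠ d) ∧ G.Adj a b ∧ G.Adj c d := by
  have h3 := ho.three_le
  have hm := fun {i} (hi : i ≤ k) => mem_obstructionVerts_path (q := q) (e := e) hi
  have hme : e ∈ obstructionVerts k q e := mem_obstructionVerts_apex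
  have hne := fun {i j} (hi : i ≤ k) (hj : j ≤ k) (h : i ≠ j) => ho.ne hi hj h
  by_cases h0 : q 0 = n
  · subst h0
    exact ⟨q 1, hm (by omega), q 2, hm (by omega), q k, hm le_rfl, e, hme,
      ⟨hne (by omega) (by omega) (by omega), hne (by omega) (by omega) (by omega),
        hne (by omega) (by omega) (by omega), ho.apex_ne (by omega)⟩,
      ⟨hne (by omega) (by omega) (by omega), (ho.apex_ne (by omega)).symm,
        hne (by omega) (by omega) (by omega), (ho.apex_ne (by omega)).symm⟩,
      ho.adj_succ (by omega), ho.adj_last.symm⟩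
  by_cases h1 : q 1 = n
  · subst h1
    exact ⟨e, hme, q 0, hm (by omega), q 2, hm (by omega), q 3, hm h3,
      ⟨ho.apex_ne (by omega), hne (by omega) (by omega) (by omega),
        hne (by omega) (by omega) (by omega), hne (by omega) (by omega) (by omega)⟩,
      ⟨ho.apex_ne (by omega), ho.apex_ne (by omega), hne (by omega) (by omega) (by omega),
        hne (by omega) (by omega) (by omega)⟩, ho.adj_first, ho.adj_succ (by omega)⟩
  by_cases h2 : q 2 = n
  · subst h2
    exact ⟨q 0, hm (by omega), q 1, hm (by omega), q k, hm le_rfl, e, hme,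
      ⟨hne (by omega) (by omega) (by omega), hne (by omega) (by omega) (by omega),
        hne (by omega) (by omega) (by omega), ho.apex_ne (by omega)⟩,
      ⟨hne (by omega) (by omega) (by omega), (ho.apex_ne (by omega)).symm,
        hne (by omega) (by omega) (by omega), (ho.apex_ne (by omega)).symm⟩,
      ho.adj_succ (by omega), ho.adj_last.symm⟩
  by_cases h3' : q 3 = n
  · subst h3'
    exact ⟨e, hme, q 0, hm (by omega), q 1, hm (by omega), q 2, hm (by omega),
      ⟨ho.apex_ne (by omega), hne (by omega) (by omega) (by omega),
        hne (by omega) (by omega) (by omega), hne (by omega) (by omega) (by omega)⟩,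
      ⟨ho.apex_ne (by omega), ho.apex_ne (by omega), hne (by omega) (by omega) (by omega),
        hne (by omega) (by omega) (by omega)⟩, ho.adj_first, ho.adj_succ (by omega)⟩
  exact ⟨q 0, hm (by omega), q 1, hm (by omega), q 2, hm (by omega), q 3, hm h3, ⟨h0, h1, h2, h3'⟩,
    ⟨hne (by omega) (by omega) (by omega), hne (by omega) (by omega) (by omega),
      hne (by omega) (by omega) (by omega), hne (by omega) (by omega) (by omega)⟩,
    ho.adj_succ (by omega), ho.adj_succ (by omega)⟩

end Obstruction

/-! ### Splits of distance hereditary graphs -/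

theorem SimpleGraph.Connected.exists_adj_boundary {V : Type*} {G : SimpleGraph V}
    (hG : G.Connected) {A : Set V} {x y : V} (hx : x ∈ A) (hy : y ∉ A) :
    ∃ a ∈ A, ∃ b ∉ A, G.Adj a b := by
  obtain ⟨p⟩ := hG.preconnected x y
  obtain ⟨d, -, h1, h2⟩ := p.exists_boundary_dart A hx hy
  exact ⟨_, h1, _, h2, d.adj⟩

theorem HasShortcuts.of_embedding {V W : Type*} {G : SimpleGraph V} {L : SimpleGraph W}
    (h : HasShortcuts G) (φ : L ↪g G) : HasShortcuts L := by
  by_contra hL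
  obtain ⟨k, q, e, ho⟩ := exists_isObstruction hL
  refine IsObstruction.not_hasShortcuts (k := k) (q := fun i => φ (q i)) (e := φ e) ⟨ho.three_le,
    fun i hi j hj => ?_, ?_, ?_⟩ h
  · rw [φ.map_adj_iff]; exact ho.adj_iff i hi j hj
  · rw [φ.map_adj_iff]; exact ho.adj_first
  · rw [φ.map_adj_iff]; exact ho.adj_last

theorem isSplit_of_twins {W : Type*} {L : SimpleGraph W} {u v : W} (huv : u ≠ v)
    (h : ∀ w, w ≠ u → w ≠ v → (L.Adj w u ↔ L.Adj w v)) {x y : W} (hxy : x ≠ y)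
    (hxu : x ≠ u) (hxv : x ≠ v) (hyu : y ≠ u) (hyv : y ≠ v) : IsSplit L {u, v} {u, v}ᶜ := by
  refine ⟨isCompl_compl, ⟨u, by simp, v, by simp, huv⟩, ⟨x, by simp [hxu, hxv], y,
    by simp [hyu, hyv], hxy⟩, ?_⟩
  rintro a ⟨ha, b, hb, hab⟩ c ⟨hc, -⟩
  simp only [Set.mem_insert_iff, Set.mem_singleton_iff, not_or, Set.mem_compl_iff]
    at ha hb hc
  replace hc : c = u ∨ c = v := by tauto
  have := h a ha.1 ha.2
  rcases hb with rfl | rfl <;> rcases hc with rfl | rfl <;> tauto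

/-- If the vertices not adjacent to `v` span an edge `yz`, then the component of `y` among these
vertices is one side of a split: for `c` in the component and `a` outside it, both with a
neighbour on the other side, the walk from `c` inside the component to a neighbour of `a`, then
through `a` to `v`, can only be shortened by the edge `ca`. -/
theorem HasShortcuts.exists_split_of_not_adj {W : Type*} {L : SimpleGraph W}
    (h : HasShortcuts L) (hconn : L.Connected) {v y z : W} (hvy : v ≠ y) (hvz : v ≠ z)
    (hy : ¬ L.Adj v y) (hz : ¬ L.Adj v z) (hyz : L.Adj y z) : ∃ A B, IsSplit L A B := by
  classical
  let R : Set W := {u | ∃ p : L.Walk y u, ∀ c ∈ p.support, c ≠ v ∧ ¬ L.Adj v c}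
  have hyR : y ∈ R := ⟨.nil, by simpa using ⟨hvy.symm, hy⟩⟩
  have hzR : z ∈ R := ⟨.cons hyz .nil, by simpa using ⟨⟨hvy.symm, hy⟩, hvz.symm, hz⟩⟩
  have hR : ∀ u ∈ R, u ≠ v ∧ ¬ L.Adj v u := fun u ⟨p, hp⟩ => hp u p.end_mem_support
  have hout : ∀ u ∈ R, ∀ w ∉ R, L.Adj u w → L.Adj v w := by
    rintro u ⟨p, hp⟩ w hw huw
    by_contra hvw
    refine hw ⟨p.concat huw, fun c hc => ?_⟩
    rw [Walk.support_concat] at hc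
    rcases (by simpa using hc) with hc | rfl
    · exact hp c hc
    · refine ⟨?_, hvw⟩
      rintro rfl
      exact (hp u p.end_mem_support).2 huw.symm
  have hvR : v ∉ R := fun hv => (hR v hv).1 rfl
  obtain ⟨w, hw⟩ : ∃ w, L.Adj v w := by
    obtain ⟨p⟩ := hconn.preconnected v y
    cases p with
    | nil => exact absurd rfl hvy
    | cons h _ => exact ⟨_, h⟩
  refine ⟨R, Rᶜ, isCompl_compl, ⟨y, hyR, z, hzR, hyz.ne⟩,
    ⟨v, hvR, w, fun hwR => (hR w hwR).2 hw, hw.ne⟩, ?_⟩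
  rintro a ⟨haR, b, hb, hab⟩ c ⟨hcR, d, hd, hcd⟩
  simp only [Set.mem_compl_iff, not_not] at hcR hd
  have hva := hout b hb a haR hab.symm
  have hvd := hout c hcR d hd hcd
  have hbR : b ∈ R := hb
  have hcR' : c ∈ R := hcR
  obtain ⟨p, hp⟩ := hb
  obtain ⟨r, hr⟩ := hcR
  -- the walk from `c` inside `R` to `b`, then through `a` to `v`
  have hsub : ∀ x ∈ (r.reverse.append p).support, x ∈ R := by
    intro x hx
    rw [Walk.mem_support_append_iff, Walk.support_reverse, List.mem_reverse] at hx
    rcases hx with hx | hx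
    · exact ⟨r.takeUntil x hx, fun t ht => hr t (r.support_takeUntil_subset_support hx ht)⟩
    · exact ⟨p.takeUntil x hx, fun t ht => hp t (p.support_takeUntil_subset_support hx ht)⟩
  rcases h c v d (((r.reverse.append p).concat hab.symm).concat hva.symm) hcd.symm hvd.symm with
    h' | h' | ⟨t, ht, hct, htv⟩
  · exact absurd h' (hR c hcR').1
  · exact absurd h'.symm (hR c hcR').2
  · rw [Walk.support_concat, Walk.support_concat] at ht
    simp only [List.mem_append, List.mem_singleton] at ht
    rcases ht with (ht | rfl) | rfl
    · exact absurd htv.symm (hR t (hsub t ht)).2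
    · exact hct.symm
    · exact absurd htv (L.irrefl)

/-- A connected distance hereditary graph with at least four vertices is not prime. If no
`exists_split_of_not_adj` applies, non-adjacency is transitive, so the graph is complete
multipartite and has twins. -/
theorem HasShortcuts.exists_split {W : Type*} [Finite W] {L : SimpleGraph W}
    (h : HasShortcuts L) (hconn : L.Connected) (hcard : 4 ≤ Nat.card W) :
    ∃ A B, IsSplit L A B := by
  classical
  have hex : ∀ u v : W, ∃ x y : W, x ≠ y ∧ x ≠ u ∧ x ≠ v ∧ y ≠ u ∧ y ≠ v := by
    intro u v
    have : Fintype W := Fintype.ofFinite W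
    have h1 : 1 < (({u, v} : Finset W)ᶜ).card := by
      rw [Finset.card_compl, ← Nat.card_eq_fintype_card]
      have := Finset.card_le_two (a := u) (b := v)
      omega
    obtain ⟨x, hx, y, hy, hxy⟩ := Finset.one_lt_card.1 h1
    simp at hx hy
    exact ⟨x, y, hxy, by tauto, by tauto, by tauto, by tauto⟩
  by_contra hno
  have htrans : ∀ v y z : W, v ≠ y → v ≠ z → ¬ L.Adj v y → ¬ L.Adj v z → ¬ L.Adj y z :=
    fun v y z hvy hvz hy hz hyz => hno (h.exists_split_of_not_adj hconn hvy hvz hy hz hyz)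
  have htw : ∃ u v : W, u ≠ v ∧ ∀ w, w ≠ u → w ≠ v → (L.Adj w u ↔ L.Adj w v) := by
    by_cases hall : ∀ u v : W, u ≠ v → L.Adj u v
    · obtain ⟨u⟩ := hconn.nonempty
      obtain ⟨v, _, _, hv, _⟩ := hex u u
      exact ⟨u, v, hv.symm, fun w hu hv => by simp [hall w u hu, hall w v hv]⟩
    · push Not at hall
      obtain ⟨u, v, huv, hna⟩ := hall
      refine ⟨u, v, huv, fun w hu hv => ⟨fun hw => ?_, fun hw => ?_⟩⟩
      · by_contra hw'
        exact htrans v u w huv.symm hv.symm (fun h => hna h.symm) (fun h => hw' h.symm) hw.symm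
      · by_contra hw'
        exact htrans u v w huv hu.symm hna (fun h => hw' h.symm) hw.symm
  obtain ⟨u, v, huv, h2⟩ := htw
  obtain ⟨x, y, hxy, a1, a2, a3, a4⟩ := hex u v
  exact hno ⟨_, _, isSplit_of_twins huv h2 hxy a1 a2 a3 a4⟩

theorem SimpleGraph.Connected.isDegenerateGraph_of_card_le_three {W : Type*} [Finite W]
    {L : SimpleGraph W} (hconn : L.Connected) (hcard : Nat.card W ≤ 3) : IsDegenerateGraph L := by
  classical
  by_cases hall : ∀ u v : W, u ≠ v → L.Adj u v
  · exact Or.inl hall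
  push Not at hall
  obtain ⟨u, v, huv, hna⟩ := hall
  have hadj : ∀ x y : W, x ≠ y → ∃ z, L.Adj x z := by
    intro x y hxy
    obtain ⟨p⟩ := hconn.preconnected x y
    cases p with
    | nil => exact absurd rfl hxy
    | cons h _ => exact ⟨_, h⟩
  obtain ⟨c, huc⟩ := hadj u v huv
  have hcv : c ≠ v := by rintro rfl; exact hna huc
  have hw : ∀ w, w = u ∨ w = v ∨ w = c := by
    intro w
    by_contra hw
    push Not at hw
    have : Fintype W := Fintype.ofFinite W
    have h4 : ({u, v, c, w} : Finset W).card = 4 := by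
      rw [Finset.card_insert_of_notMem, Finset.card_insert_of_notMem,
        Finset.card_insert_of_notMem] <;> simp [huv, huc.ne, hcv.symm, hw.1.symm, hw.2.1.symm,
          hw.2.2.symm]
    have := Finset.card_le_univ ({u, v, c, w} : Finset W)
    rw [h4, ← Nat.card_eq_fintype_card] at this
    omega
  obtain ⟨d, hvd⟩ := hadj v u huv.symm
  have hvc : L.Adj v c := by
    rcases hw d with rfl | rfl | rfl
    · exact absurd hvd.symm hna
    · exact absurd hvd L.irrefl
    · exact hvd
  refine Or.inr ⟨c, fun a b => ⟨fun h => ⟨h.ne, ?_⟩, ?_⟩⟩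
  · rcases hw a with rfl | rfl | rfl <;> rcases hw b with rfl | rfl | rfl <;>
      simp_all [L.adj_comm]
  · rintro ⟨hab, rfl | rfl⟩
    · rcases hw b with rfl | rfl | rfl <;> first | exact huc.symm | exact hvc.symm | simp_all
    · rcases hw a with rfl | rfl | rfl <;> first | exact huc | exact hvc | simp_all

theorem HasShortcuts.isDegenerateGraph {W : Type*} [Finite W] {L : SimpleGraph W}
    (h : HasShortcuts L) (hconn : L.Connected) (hL : IsPrimeGraph L ∨ IsDegenerateGraph L) :
    IsDegenerateGraph L := by
  rcases hL with hL | hL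
  · rcases Nat.lt_or_ge 3 (Nat.card W) with hc | hc
    · exact absurd (h.exists_split hconn hc) hL
    · exact hconn.isDegenerateGraph_of_card_le_three hc
  · exact hL

/-! ### Branches, paths and accessibility in graph-labelled trees -/

namespace GraphLabelledTree

variable {N : Type*} (T : GraphLabelledTree N)

/-- The tree-edges `vw` and `vw'` exist and their marker vertices are adjacent in the label of
`v`. -/
def MarkersAdj (v w w' : N) : Prop :=
  ∃ (hw : T.tree.Adj v w) (hw' : T.tree.Adj v w'), (T.label v).Adj ⟨w, hw⟩ ⟨w', hw'⟩

/-- Any two distinct tree-edges in `E` with a common vertex have adjacent marker vertices there.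
-/
def AdjAlong (E : List (Sym2 N)) : Prop :=
  ∀ v w w' : N, T.tree.Adj v w → T.tree.Adj v w' → w ≠ w' → s(w, v) ∈ E → s(v, w') ∈ E →
    T.MarkersAdj v w w'

variable {T}

theorem MarkersAdj.symm {v w w' : N} (h : T.MarkersAdj v w w') : T.MarkersAdj v w' w :=
  ⟨h.2.1, h.1, h.2.2.symm⟩

theorem AdjAlong.mono {E E' : List (Sym2 N)} (h : T.AdjAlong E) (hE : E' ⊆ E) : T.AdjAlong E' :=
  fun v w w' hw hw' hne h1 h2 => h v w w' hw hw' hne (hE h1) (hE h2)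

theorem accessible_iff_adjAlong {l u : N} {p : T.tree.Walk l u} (hp : p.IsPath) :
    T.Accessible l u ↔ l ≠ u ∧ T.AdjAlong p.edges := by
  refine and_congr_right fun _ => ⟨fun h v w w' hw hw' hne h1 h2 => ?_,
    fun h q hq v w w' hne h1 h2 => ?_⟩
  · exact ⟨hw, hw', h p hp v ⟨w, hw⟩ ⟨w', hw'⟩ (fun h => hne (congrArg Subtype.val h)) h1 h2⟩
  · have : q = p := (T.isTree.existsUnique_path l u).unique hq hp
    subst this
    exact (h v w w' w.2 w'.2 (fun h => hne (Subtype.ext h)) h1 h2).2.2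

theorem Accessible.symm {l u : N} (h : T.Accessible l u) : T.Accessible u l := by
  obtain ⟨hne, h⟩ := h
  refine ⟨hne.symm, fun p hp v w w' hw h1 h2 => h p.reverse hp.reverse v w w' hw ?_ ?_⟩
  · simpa using h1
  · simpa using h2

theorem accessible_comm {l u : N} : T.Accessible l u ↔ T.Accessible u l :=
  ⟨Accessible.symm, Accessible.symm⟩

theorem exists_path_of_mem_branch {u w z : N} (h : z ∈ T.branch u w) :
    ∃ p : T.tree.Walk w z, p.IsPath ∧ u ∉ p.support := by
  classical
  obtain ⟨p, hp⟩ := h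
  exact ⟨p.bypass, p.bypass_isPath, fun h => hp (p.support_bypass_subset_support h)⟩

theorem self_mem_branch {u w : N} (h : T.tree.Adj u w) : w ∈ T.branch u w :=
  ⟨.nil, by simpa using h.ne⟩

theorem notMem_branch (u w : N) : u ∉ T.branch u w := fun ⟨p, hp⟩ => hp p.end_mem_support

theorem mem_branch_of_mem_support {u w z x : N} {p : T.tree.Walk w z} (hp : u ∉ p.support)
    (hx : x ∈ p.support) : x ∈ T.branch u w := by
  classical
  exact ⟨p.takeUntil x hx, fun h => hp (p.support_takeUntil_subset_support hx h)⟩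

theorem eq_of_mem_branch {u w w' z : N} (hw : T.tree.Adj u w) (hw' : T.tree.Adj u w')
    (h : z ∈ T.branch u w) (h' : z ∈ T.branch u w') : w = w' := by
  obtain ⟨p, hp, hu⟩ := exists_path_of_mem_branch h
  obtain ⟨q, hq, hu'⟩ := exists_path_of_mem_branch h'
  have := (T.isTree.existsUnique_path u z).unique
    ((Walk.cons_isPath_iff hw p).2 ⟨hp, hu⟩) ((Walk.cons_isPath_iff hw' q).2 ⟨hq, hu'⟩)
  have := congrArg Walk.snd this
  simpa using this

theorem exists_mem_branch {u z : N} (h : z ≠ u) : ∃ w, T.tree.Adj u w ∧ z ∈ T.branch u w := by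
  obtain ⟨p, hp⟩ := (T.isTree.existsUnique_path u z).exists
  cases p with
  | nil => exact absurd rfl h
  | cons hw p => exact ⟨_, hw, p, ((Walk.cons_isPath_iff _ _).1 hp).2⟩

theorem mem_branch_of_notMem_branch {a b z : N} (hab : T.tree.Adj a b) (h : z ∉ T.branch a b) :
    z ∈ T.branch b a := by
  by_cases hz : z = a
  · rw [hz]
    exact self_mem_branch hab.symm
  obtain ⟨w, hw, p, hp⟩ := exists_mem_branch hz
  have hb : b ∉ p.support := by
    intro hb
    exact h (eq_of_mem_branch hw hab (mem_branch_of_mem_support hp hb) (self_mem_branch hab) ▸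
      ⟨p, hp⟩)
  exact ⟨.cons hw p, by simpa using ⟨hab.ne', hb⟩⟩

theorem notMem_branch_of_mem_branch {a b z : N} (hab : T.tree.Adj a b) (h : z ∈ T.branch a b) :
    z ∉ T.branch b a := by
  intro h'
  obtain ⟨p, hp, hu⟩ := exists_path_of_mem_branch h
  obtain ⟨q, hq, hu'⟩ := exists_path_of_mem_branch h'
  have := (T.isTree.existsUnique_path a z).unique ((Walk.cons_isPath_iff hab p).2 ⟨hp, hu⟩) hq
  subst this
  simp at hu'

theorem mem_branch_iff {a b z : N} (hab : T.tree.Adj a b) : z ∈ T.branch b a ↔ z ∉ T.branch a b :=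
  ⟨fun h h' => notMem_branch_of_mem_branch hab h' h, mem_branch_of_notMem_branch hab⟩

theorem branch_subset {a b w : N} (hab : T.tree.Adj a b) (hw : T.tree.Adj a w) (hne : w ≠ b) :
    T.branch a w ⊆ T.branch b a := fun _ hz =>
  mem_branch_of_notMem_branch hab fun h => hne (eq_of_mem_branch hw hab hz h)

theorem exists_mem_branch_of_mem_branch {a b z : N} (hab : T.tree.Adj a b)
    (h : z ∈ T.branch b a) (hz : z ≠ a) : ∃ w, T.tree.Adj a w ∧ w ≠ b ∧ z ∈ T.branch a w := by
  obtain ⟨w, hw, hzw⟩ := exists_mem_branch hz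
  exact ⟨w, hw, fun hwb => (mem_branch_iff hab).1 h (hwb ▸ hzw), hzw⟩

theorem eq_of_isLeaf_of_mem_branch {a b z : N} (hab : T.tree.Adj a b) (ha : T.IsLeaf a)
    (h : z ∈ T.branch b a) : z = a := by
  by_contra hz
  obtain ⟨w, hw, hne, -⟩ := exists_mem_branch_of_mem_branch hab h hz
  exact hne (ha hw hab)

theorem isPath_of_mem_branch {v w w' l u : N} (hw : T.tree.Adj v w) (hw' : T.tree.Adj v w')
    (hne : w ≠ w') {p : T.tree.Walk w l} (hp : p.IsPath) (hv : v ∉ p.support)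
    {q : T.tree.Walk w' u} (hq : q.IsPath) (hv' : v ∉ q.support) :
    ((Walk.cons hw p).reverse.append (Walk.cons hw' q)).IsPath := by
  have h1 : (Walk.cons hw p).reverse.IsPath := ((Walk.cons_isPath_iff hw p).2 ⟨hp, hv⟩).reverse
  rw [Walk.isPath_def, Walk.support_append, Walk.support_cons, List.tail_cons, List.nodup_append]
  refine ⟨h1.support_nodup, hq.support_nodup, ?_⟩
  rintro x hx y hy rfl
  simp only [Walk.support_reverse, List.mem_reverse, Walk.support_cons, List.mem_cons] at hx
  rcases hx with rfl | hx
  · exact hv' hy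
  · exact hne (eq_of_mem_branch hw hw' (mem_branch_of_mem_support hv hx)
      (mem_branch_of_mem_support hv' hy))

/-- Accessibility between two tree-vertices in different branches at `v` is decided by the two
halves of the path between them and by the label of `v`. -/
theorem accessible_iff_of_mem_branch {v w w' l u : N} (hw : T.tree.Adj v w)
    (hw' : T.tree.Adj v w') (hne : w ≠ w') (hl : l ∈ T.branch v w) (hu : u ∈ T.branch v w') :
    T.Accessible l u ↔ T.Accessible l v ∧ T.Accessible u v ∧ T.MarkersAdj v w w' := by
  obtain ⟨p, hp, hv⟩ := exists_path_of_mem_branch hl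
  obtain ⟨q, hq, hv'⟩ := exists_path_of_mem_branch hu
  have hpp := (Walk.cons_isPath_iff hw p).2 ⟨hp, hv⟩
  have hqq := (Walk.cons_isPath_iff hw' q).2 ⟨hq, hv'⟩
  have hlu : l ≠ u := fun h => hne (eq_of_mem_branch hw hw' hl (h ▸ hu))
  have hlv : v ≠ l := fun h => notMem_branch (T := T) v w (by rwa [← h] at hl)
  have huv : v ≠ u := fun h => notMem_branch (T := T) v w' (by rwa [← h] at hu)
  rw [accessible_comm (u := v), accessible_comm (u := v) (l := u), accessible_iff_adjAlong hpp,
    accessible_iff_adjAlong hqq,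
    accessible_iff_adjAlong (isPath_of_mem_branch hw hw' hne hp hv hq hv')]
  simp only [hlu, hlv, huv, ne_eq, not_false_eq_true, true_and, Walk.edges_append,
    Walk.edges_reverse]
  -- an edge of the path that contains `v` is the first edge of one of its two halves
  have hfst : ∀ {c z : N} (hc : T.tree.Adj v c) (r : T.tree.Walk c z), v ∉ r.support →
      ∀ x, s(v, x) ∈ (Walk.cons hc r).edges → x = c := by
    intro c z hc r hr x hx
    rcases List.mem_cons.1 (by simpa only [Walk.edges_cons] using hx) with hx | hx
    · exact Sym2.congr_right.1 hx
    · exact absurd (r.fst_mem_support_of_mem_edges hx) hr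
  -- the two halves of the path meet in `v` only
  have hmeet : ∀ x, x ∈ (Walk.cons hw p).support → x ∈ (Walk.cons hw' q).support → x = v := by
    intro x hx hx'
    by_contra hxv
    simp only [Walk.support_cons, List.mem_cons, hxv, false_or] at hx hx'
    exact hne (eq_of_mem_branch hw hw' (mem_branch_of_mem_support hv hx)
      (mem_branch_of_mem_support hv' hx'))
  constructor
  · intro h
    refine ⟨h.mono (by simp), h.mono (by simp), h v w w' hw hw' hne ?_ ?_⟩
    · rw [Sym2.eq_swap]; simp
    · simp
  · rintro ⟨h1, h2, h3⟩ x y y' hy hy' hyy e1 e2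
    simp only [List.mem_append, List.mem_reverse] at e1 e2
    rcases e1 with e1 | e1 <;> rcases e2 with e2 | e2
    · exact h1 x y y' hy hy' hyy e1 e2
    · obtain rfl := hmeet x (Walk.snd_mem_support_of_mem_edges _ e1)
        (Walk.fst_mem_support_of_mem_edges _ e2)
      obtain rfl := hfst hw p hv y (by rwa [Sym2.eq_swap])
      obtain rfl := hfst hw' q hv' y' e2
      exact h3
    · obtain rfl := hmeet x (Walk.fst_mem_support_of_mem_edges _ e2)
        (Walk.snd_mem_support_of_mem_edges _ e1)
      obtain rfl := hfst hw' q hv' y (by rwa [Sym2.eq_swap])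
      obtain rfl := hfst hw p hv y' e2
      exact h3.symm
    · exact h2 x y y' hy hy' hyy e1 e2

theorem accessible_of_adj {a b : N} (hab : T.tree.Adj a b) : T.Accessible a b := by
  rw [accessible_iff_adjAlong (p := .cons hab .nil) (by simpa using hab.ne)]
  refine ⟨hab.ne, fun v w w' _ _ hne h1 h2 => absurd ?_ hne⟩
  simp only [Walk.edges_cons, Walk.edges_nil, List.mem_singleton] at h1 h2
  rw [Sym2.eq_swap, ← h2] at h1
  exact Sym2.congr_right.1 h1

theorem accessible_neighbor_iff {a b w l : N} (hab : T.tree.Adj a b) (hw : T.tree.Adj a w)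
    (hne : w ≠ b) (hl : l ∈ T.branch a w) :
    T.Accessible l b ↔ T.Accessible l a ∧ T.MarkersAdj a w b := by
  rw [accessible_iff_of_mem_branch hw hab hne hl (self_mem_branch hab)]
  simp [accessible_of_adj hab.symm]

theorem accessible_iff_of_adj {a b l u : N} (hab : T.tree.Adj a b) (hl : l ∈ T.branch b a)
    (hu : u ∈ T.branch a b) : T.Accessible l u ↔ T.Accessible l b ∧ T.Accessible u a := by
  by_cases hla : l = a
  · subst hla
    simp [accessible_of_adj hab, accessible_comm (l := u)]
  · obtain ⟨w, hw, hne, hlw⟩ := exists_mem_branch_of_mem_branch hab hl hla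
    rw [accessible_iff_of_mem_branch hw hab hne hlw hu, accessible_neighbor_iff hab hw hne hlw]
    tauto

theorem orientedTowards_iff {v c u : N} (hc : T.tree.Adj v c) :
    T.OrientedTowards v c u ↔ u ∈ T.branch v c := by
  constructor
  · rintro ⟨p, hp, he⟩
    cases p with
    | nil => simp at he
    | @cons _ w _ hw p =>
      rw [Walk.cons_isPath_iff] at hp
      rcases List.mem_cons.1 (by simpa only [Walk.edges_cons] using he) with h | h
      · obtain rfl : c = w := Sym2.congr_right.1 h
        exact ⟨p, hp.2⟩
      · exact absurd (p.fst_mem_support_of_mem_edges h) hp.2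
  · intro h
    obtain ⟨p, hp, hv⟩ := exists_path_of_mem_branch h
    exact ⟨.cons hc p, (Walk.cons_isPath_iff hc p).2 ⟨hp, hv⟩, by simp⟩

theorem mem_span_of_hitNeighbors {S : Set N} {v w w' : N} (hw : w ∈ T.hitNeighbors S v)
    (hw' : w' ∈ T.hitNeighbors S v) (hne : w ≠ w') : v ∈ T.span S := by
  obtain ⟨hw, l, hl, hlw⟩ := hw
  obtain ⟨hw', l', hl', hlw'⟩ := hw'
  obtain ⟨p, hp, hv⟩ := exists_path_of_mem_branch hlw
  obtain ⟨q, hq, hv'⟩ := exists_path_of_mem_branch hlw'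
  exact ⟨l, hl, l', hl', _, isPath_of_mem_branch hw hw' hne hp hv hq hv', by simp⟩

theorem exists_hitNeighbors_of_mem_span {S : Set N} {v : N} (hv : v ∈ T.span S) (hvS : v ∉ S) :
    ∃ w ∈ T.hitNeighbors S v, ∃ w' ∈ T.hitNeighbors S v, w ≠ w' := by
  classical
  obtain ⟨a, ha, b, hb, p, hp, hvp⟩ := hv
  obtain ⟨w, hw, haw⟩ := exists_mem_branch (T := T) (fun h : a = v => hvS (h ▸ ha))
  obtain ⟨w', hw', hbw⟩ := exists_mem_branch (T := T) (fun h : b = v => hvS (h ▸ hb))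
  refine ⟨w, ⟨hw, a, ha, haw⟩, w', ⟨hw', b, hb, hbw⟩, ?_⟩
  rintro rfl
  obtain ⟨r, hr⟩ := haw
  obtain ⟨s, hs⟩ := hbw
  have : p = (r.reverse.append s).bypass :=
    (T.isTree.existsUnique_path a b).unique hp (Walk.bypass_isPath _)
  rw [this] at hvp
  have := Walk.support_bypass_subset_support _ hvp
  rw [Walk.mem_support_append_iff, Walk.support_reverse, List.mem_reverse] at this
  tauto

theorem exists_ne_hitNeighbors_of_mem_span {S : Set N} {v : N} (hv : v ∈ T.span S) (hvS : v ∉ S)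
    (u : N) : ∃ w ∈ T.hitNeighbors S v, w ≠ u := by
  obtain ⟨w, hw, w', hw', hne⟩ := exists_hitNeighbors_of_mem_span hv hvS
  by_cases h : w = u
  · exact ⟨w', hw', fun h' => hne (h.trans h'.symm)⟩
  · exact ⟨w, hw, h⟩

theorem exists_isLeaf_mem_branch [Finite N] {a b : N} (hab : T.tree.Adj a b) :
    ∃ l ∈ T.branch a b, T.IsLeaf l := by
  induction hn : (T.branch a b).ncard using Nat.strong_induction_on generalizing a b with
  | _ n ih =>
    by_cases hb : T.IsLeaf b
    · exact ⟨b, self_mem_branch hab, hb⟩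
    · obtain ⟨w, hw, hwa⟩ := (Set.not_subsingleton_iff.1 hb).exists_ne a
      have hsub := branch_subset hab.symm hw hwa
      have hlt : (T.branch b w).ncard < n := by
        rw [← hn]
        exact Set.ncard_lt_ncard ⟨hsub, fun h => notMem_branch b w (h (self_mem_branch hab))⟩
      obtain ⟨l, hl, hl'⟩ := ih _ hlt hw rfl
      exact ⟨l, hsub hl, hl'⟩

theorem mem_branch_of_adj {v c a b : N} (ha : a ∈ T.branch v c) (hab : T.tree.Adj a b)
    (hb : b ≠ v) : b ∈ T.branch v c := by
  obtain ⟨p, hp⟩ := ha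
  refine ⟨p.concat hab, ?_⟩
  rw [Walk.support_concat]
  simpa using ⟨hp, hb.symm⟩

theorem branch_subset_of_mem_branch {u v w w' q : N} (hw : T.tree.Adj u w)
    (hw' : T.tree.Adj u w') (hne : w' ≠ w) (hv : v ∈ T.branch u w) (hu : u ∈ T.branch v q) :
    T.branch u w' ⊆ T.branch v q := by
  rintro y ⟨r, hr⟩
  obtain ⟨p, hp⟩ := hu
  refine ⟨p.append (.cons hw' r), ?_⟩
  rw [Walk.mem_support_append_iff, Walk.support_cons, List.mem_cons]
  rintro (h | h | h)
  · exact hp h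
  · exact hp (h ▸ p.end_mem_support)
  · exact hne (eq_of_mem_branch hw' hw (mem_branch_of_mem_support hr h) hv)

/-- For a tree-edge `ab` with `b ≠ v`, orientation towards the edge is orientation towards `b`. -/
theorem orientedTowardsEdge_iff {v c a b : N} (hc : T.tree.Adj v c) (hab : T.tree.Adj a b)
    (hb : b ≠ v) : T.OrientedTowardsEdge v c a b ↔ b ∈ T.branch v c := by
  rw [OrientedTowardsEdge, orientedTowards_iff hc, orientedTowards_iff hc]
  exact ⟨fun h => h.elim (fun h => mem_branch_of_adj h hab hb) id, Or.inr⟩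

theorem subset_span (S : Set N) : S ⊆ T.span S := fun a ha =>
  ⟨a, ha, a, ha, .nil, by simp, by simp⟩

theorem neighbor_mem_span_of_hitNeighbors {S : Set N} {v w w' : N} (hw : w ∈ T.hitNeighbors S v)
    (hw' : w' ∈ T.hitNeighbors S v) (hne : w ≠ w') : w ∈ T.span S := by
  obtain ⟨hw, l, hl, hlw⟩ := hw
  obtain ⟨hw', l', hl', hlw'⟩ := hw'
  obtain ⟨p, hp, hv⟩ := exists_path_of_mem_branch hlw
  obtain ⟨q, hq, hv'⟩ := exists_path_of_mem_branch hlw'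
  exact ⟨l, hl, l', hl', _, isPath_of_mem_branch hw hw' hne hp hv hq hv',
    (Walk.mem_support_append_iff _ _).2 (Or.inl (by simp))⟩

end GraphLabelledTree

/-! ### Two bad sides of a split after adding a vertex -/

/-- The features of a side `A` of a split, with frontier `D`, that come from a tree-node whose
markers other than the one at the split are pairwise adjacent (`c` true: a clique) or pairwise
non-adjacent (`c` false: a star with its centre at the split). The frontier is not split by any
set `P` into two nonempty parts without a pair of relation `c` across, and an element `s` of `A`
outside the frontier misses some frontier vertex related by `c` to a given frontier neighbour of
`s`. -/
structure JoinSide {V : Type*} (G : SimpleGraph V) (A D : Set V) (c : Prop) : Prop where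
  exists_adj_iff : ∀ P : Set V, (D ∩ P).Nonempty → (D \ P).Nonempty →
    ∃ t ∈ D ∩ P, ∃ t' ∈ D \ P, (G.Adj t t' ↔ c)
  exists_not_adj : ∀ s ∈ A \ D, ∀ d ∈ D, G.Adj s d → ∃ d' ∈ D, (G.Adj d d' ↔ c) ∧ ¬ G.Adj s d'

/-- The feature of a side `A` of a split, with frontier `D`, that comes from a star node with an
extremity at the split: some vertex of `A` outside the frontier is adjacent to all of the
frontier. -/
def PendantSide {V : Type*} (G : SimpleGraph V) (A D : Set V) : Prop :=
  ∃ y ∈ A \ D, ∀ d ∈ D, G.Adj y d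

/-- Covers the house, the gem and the cycle of length five. -/
theorem HasShortcuts.false_of_path_four {V : Type*} {G : SimpleGraph V} (h : HasShortcuts G)
    {a b c d e : V} (hab : G.Adj a b) (hbc : G.Adj b c) (hcd : G.Adj c d)
    (hac : ¬ G.Adj a c) (hbd : ¬ G.Adj b d) (had : ¬ G.Adj a d) (hne : a ≠ d)
    (hea : G.Adj e a) (hed : G.Adj e d) : False := by
  rcases h a d e (.cons hab (.cons hbc (.cons hcd .nil))) hea hed with h | h | ⟨x, hx, h1, h2⟩
  · exact hne h
  · exact had h
  · simp only [Walk.support_cons, Walk.support_nil, List.mem_cons, List.not_mem_nil,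
      or_false] at hx
    rcases hx with rfl | rfl | rfl | rfl
    · exact G.irrefl h1
    · exact hbd h2
    · exact hac h1
    · exact G.irrefl h2

/-- Covers the domino. -/
theorem HasShortcuts.false_of_path_five {V : Type*} {G : SimpleGraph V} (h : HasShortcuts G)
    {a b c d f e : V} (hab : G.Adj a b) (hbc : G.Adj b c) (hcd : G.Adj c d) (hdf : G.Adj d f)
    (hac : ¬ G.Adj a c) (had : ¬ G.Adj a d) (hbf : ¬ G.Adj b f) (haf : ¬ G.Adj a f) (hne : a ≠ f)
    (hea : G.Adj e a) (hef : G.Adj e f) : False := by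
  rcases h a f e (.cons hab (.cons hbc (.cons hcd (.cons hdf .nil)))) hea hef with
    h | h | ⟨x, hx, h1, h2⟩
  · exact hne h
  · exact haf h
  · simp only [Walk.support_cons, Walk.support_nil, List.mem_cons, List.not_mem_nil,
      or_false] at hx
    rcases hx with rfl | rfl | rfl | rfl | rfl
    · exact G.irrefl h1
    · exact hbf h2
    · exact hac h1
    · exact had h1
    · exact G.irrefl h2

section addVertex

variable {V : Type*} {G : SimpleGraph V} {S : Set V}

theorem addVertex_some_some {a b : V} : (addVertex G S).Adj (some a) (some b) ↔ G.Adj a b := Iff.rfl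

theorem addVertex_some_none {b : V} : (addVertex G S).Adj (some b) none ↔ b ∈ S := Iff.rfl

/-- `G` is an induced subgraph of `G + (x, S)`. -/
def addVertexEmbedding (G : SimpleGraph V) (S : Set V) : G ↪g addVertex G S where
  toFun := some
  inj' := Option.some_injective V
  map_rel_iff' := Iff.rfl

variable {A B DA DB : Set V}

/-- Otherwise there is a house or a gem on these four vertices and the new vertex. -/
theorem adj_of_addVertex_hasShortcuts (hH : HasShortcuts (addVertex G S)) (hDA : DA ⊆ A)
    (hDB : DB ⊆ B) (hcut : ∀ a ∈ A, ∀ b ∈ B, (G.Adj a b ↔ a ∈ DA ∧ b ∈ DB)) {s t s' t' : V}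
    (hs : s ∈ DA) (hsS : s ∈ S) (ht : t ∈ DB) (htS : t ∈ S) (hs' : s' ∈ DA) (hsS' : s' ∉ S)
    (ht' : t' ∈ DB) (htS' : t' ∉ S) : G.Adj t t' := by
  by_contra hn
  have h1 := fun {a b} (ha : a ∈ DA) (hb : b ∈ DB) => (hcut a (hDA ha) b (hDB hb)).2 ⟨ha, hb⟩
  exact hH.false_of_path_four (a := none) (b := some t) (c := some s') (d := some t')
    (e := some s) htS (h1 hs' ht).symm (h1 hs' ht') hsS' hn htS' (by simp) hsS (h1 hs ht')

/-- Two bad sides on which `S` is contained in the frontier. -/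
theorem false_of_inter_subset (hH : HasShortcuts (addVertex G S)) (hDA : DA ⊆ A)
    (hDB : DB ⊆ B) (hcut : ∀ a ∈ A, ∀ b ∈ B, (G.Adj a b ↔ a ∈ DA ∧ b ∈ DB)) (hA : S ∩ A ⊆ DA)
    (hA1 : (DA ∩ S).Nonempty) (hA2 : (DA \ S).Nonempty) (hB1 : (DB ∩ S).Nonempty)
    (hB2 : (DB \ S).Nonempty) (h : JoinSide G A DA False ∨ PendantSide G A DA) : False := by
  have hcut' : ∀ b ∈ B, ∀ a ∈ A, (G.Adj b a ↔ b ∈ DB ∧ a ∈ DA) := fun b hb a ha => by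
    rw [G.adj_comm, hcut a ha b hb, and_comm]
  obtain ⟨t, ht, htS⟩ := hB1
  obtain ⟨t', ht', htS'⟩ := hB2
  rcases h with h | ⟨y, ⟨hyA, hyD⟩, hy⟩
  · obtain ⟨s, ⟨hs, hsS⟩, s', ⟨hs', hsS'⟩, hss⟩ := h.exists_adj_iff S hA1 hA2
    exact hss.1 (adj_of_addVertex_hasShortcuts hH hDB hDA hcut' ht htS hs hsS ht' htS' hs'
      hsS')
  · obtain ⟨s, hs, hsS⟩ := hA1
    obtain ⟨s', hs', hsS'⟩ := hA2
    have hyS : y ∉ S := fun h => hyD (hA ⟨h, hyA⟩)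
    refine hH.false_of_path_four (a := none) (b := some t) (c := some s') (d := some y)
      (e := some s) htS ((hcut _ (hDA hs') _ (hDB ht)).2 ⟨hs', ht⟩).symm (hy _ hs').symm hsS' ?_
      hyS (by simp) hsS (hy _ hs).symm
    rw [addVertex_some_some, hcut' t (hDB ht) y hyA]
    exact fun h => hyD h.2

/-- Two bad sides, where `S` contains a vertex of `A` outside the frontier. -/
theorem false_of_not_inter_subset (hG : G.Connected) (hH : HasShortcuts (addVertex G S))
    (hDA : DA ⊆ A) (hDB : DB ⊆ B) (hAB : Disjoint A B) (hU : ∀ x, x ∈ A ∨ x ∈ B)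
    (hcut : ∀ a ∈ A, ∀ b ∈ B, (G.Adj a b ↔ a ∈ DA ∧ b ∈ DB)) (hA : ¬ S ∩ A ⊆ DA)
    (hB1 : (S ∩ B).Nonempty) (hB2 : S ∩ B ≠ DB)
    (h : JoinSide G B DB True ∨ PendantSide G B DB ∨ JoinSide G A DA True ∨
      JoinSide G A DA False) : False := by
  obtain ⟨s, ⟨hsS, hsA⟩, hsD⟩ := Set.not_subset.1 hA
  have hsB : ∀ b ∈ B, ¬ G.Adj s b := fun b hb h => hsD ((hcut s hsA b hb).1 h).1
  have hne : ∀ b ∈ B, s ≠ b := fun b hb h => Set.disjoint_left.1 hAB hsA (h ▸ hb)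
  -- `s` and each element of `S ∩ B` are at distance two, because both are neighbours of `none`
  have hnear : ∀ t ∈ S ∩ B, t ∈ DB ∧ ∃ α ∈ DA, G.Adj s α := by
    rintro t ⟨htS, htB⟩
    obtain ⟨p⟩ := hG.preconnected s t
    rcases hH (some s) (some t) none (p.map (addVertexEmbedding G S).toHom) hsS htS with
      h | h | ⟨c, hc, h1, h2⟩
    · exact absurd (Option.some_injective _ h) (hne t htB)
    · exact absurd h (hsB t htB)
    · obtain ⟨α, -, rfl⟩ := List.mem_map.1 ((congrArg (c ∈ ·) (Walk.support_map _ _)).mp hc)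
      have h1 : G.Adj s α := h1
      have h2 : G.Adj α t := h2
      have hα : α ∈ A := (hU α).resolve_right fun hα => hsB α hα h1
      exact ⟨((hcut α hα t htB).1 h2).2, α, ((hcut α hα t htB).1 h2).1, h1⟩
  have hsub : S ∩ B ⊆ DB := fun t ht => (hnear t ht).1
  obtain ⟨t₀, ht₀⟩ := hB1
  obtain ⟨-, α, hα, hsα⟩ := hnear t₀ ht₀
  have hcomp : ∀ {a b}, a ∈ DA → b ∈ DB → G.Adj a b := fun {a b} ha hb =>
    (hcut a (hDA ha) b (hDB hb)).2 ⟨ha, hb⟩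
  have hP1 : (DB ∩ S).Nonempty := ⟨t₀, hsub ht₀, ht₀.1⟩
  have hP2 : (DB \ S).Nonempty := by
    by_contra hemp
    rw [Set.not_nonempty_iff_eq_empty, Set.sdiff_eq_empty] at hemp
    exact hB2 (hsub.antisymm fun t ht => ⟨hemp ht, hDB ht⟩)
  -- in each case `α` is a common neighbour of the two ends of a path that starts at `s`, except
  -- that the new vertex takes this role if `A` is of star type and `α'` is in `S`
  rcases h with h | ⟨y, ⟨hyB, hyD⟩, hy⟩ | h
  · obtain ⟨t, ⟨ht, htS⟩, t', ⟨ht', htS'⟩, htt⟩ := h.exists_adj_iff S hP1 hP2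
    exact hH.false_of_path_four (a := some s) (b := none) (c := some t) (d := some t')
      (e := some α) hsS htS (htt.2 trivial) (hsB t (hDB ht)) htS' (hsB t' (hDB ht'))
      (by simpa using hne t' (hDB ht')) hsα.symm (hcomp hα ht')
  · obtain ⟨t, ht, htS⟩ := hP1
    obtain ⟨t', ht', htS'⟩ := hP2
    exact hH.false_of_path_five (a := some s) (b := none) (c := some t) (d := some y)
      (f := some t') (e := some α) hsS htS (hy t ht).symm (hy t' ht') (hsB t (hDB ht))
      (hsB y hyB) htS' (hsB t' (hDB ht')) (by simpa using hne t' (hDB ht')) hsα.symm (hcomp hα ht')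
  · obtain ⟨t, ht, htS⟩ := hP1
    obtain ⟨t', ht', htS'⟩ := hP2
    rcases h with h | h
    · obtain ⟨α', hα', hαα, hsα'⟩ := h.exists_not_adj s ⟨hsA, hsD⟩ α hα hsα
      by_cases hS : α' ∈ S
      · exact hH.false_of_path_four (a := some s) (b := none) (c := some α') (d := some t')
          (e := some α) hsS hS (hcomp hα' ht') hsα' htS' (hsB t' (hDB ht'))
          (by simpa using hne t' (hDB ht')) hsα.symm (hcomp hα ht')
      · exact hH.false_of_path_four (a := some s) (b := none) (c := some t) (d := some α')
          (e := some α) hsS htS (hcomp hα' ht).symm (hsB t (hDB ht)) hS hsα'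
          (by simpa using fun h : s = α' => hsD (h ▸ hα')) hsα.symm (hαα.2 trivial)
    · obtain ⟨α', hα', hαα, hsα'⟩ := h.exists_not_adj s ⟨hsA, hsD⟩ α hα hsα
      by_cases hS : α' ∈ S
      · exact hH.false_of_path_four (a := some s) (b := some α) (c := some t) (d := some α')
          (e := none) hsα (hcomp hα ht) (hcomp hα' ht).symm (hsB t (hDB ht)) hαα.1 hsα'
          (by simpa using fun h : s = α' => hsD (h ▸ hα')) hsS hS
      · exact hH.false_of_path_five (a := some s) (b := none) (c := some t) (d := some α')
          (f := some t') (e := some α) hsS htS (hcomp hα' ht).symm (hcomp hα' ht')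
          (hsB t (hDB ht)) hsα' htS' (hsB t' (hDB ht')) (by simpa using hne t' (hDB ht')) hsα.symm
          (hcomp hα ht')

/-- If `G + (x, S)` is distance hereditary, a split of `G` has a side in which `S` is empty or
equal to the frontier, provided that the split is of one of the types that occur at the tree-edges
of a reduced graph-labelled tree. -/
theorem inter_eq_of_addVertex_hasShortcuts (hG : G.Connected)
    (hH : HasShortcuts (addVertex G S)) (hDA : DA ⊆ A) (hDB : DB ⊆ B) (hAB : Disjoint A B)
    (hU : ∀ x, x ∈ A ∨ x ∈ B) (hcut : ∀ a ∈ A, ∀ b ∈ B, (G.Adj a b ↔ a ∈ DA ∧ b ∈ DB))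
    (h : JoinSide G A DA False ∧ JoinSide G B DB False ∨ PendantSide G A DA ∧ PendantSide G B DB ∨
      JoinSide G A DA True ∧ (JoinSide G B DB False ∨ PendantSide G B DB) ∨
      JoinSide G B DB True ∧ (JoinSide G A DA False ∨ PendantSide G A DA)) :
    (S ∩ A = ∅ ∨ S ∩ A = DA) ∨ S ∩ B = ∅ ∨ S ∩ B = DB := by
  by_contra! hbad
  obtain ⟨⟨hA1, hA2⟩, hB1, hB2⟩ := hbad
  have hcut' : ∀ b ∈ B, ∀ a ∈ A, (G.Adj b a ↔ b ∈ DB ∧ a ∈ DA) := fun b hb a ha => by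
    rw [G.adj_comm, hcut a ha b hb, and_comm]
  by_cases hA : S ∩ A ⊆ DA
  · by_cases hB : S ∩ B ⊆ DB
    · have aux : ∀ {A DA : Set V}, DA ⊆ A → S ∩ A ⊆ DA → (S ∩ A).Nonempty → S ∩ A ≠ DA →
          (DA ∩ S).Nonempty ∧ (DA \ S).Nonempty := by
        intro A DA hDA hsub ⟨x, hx⟩ hne
        refine ⟨⟨x, hsub hx, hx.1⟩, ?_⟩
        by_contra hemp
        rw [Set.not_nonempty_iff_eq_empty, Set.sdiff_eq_empty] at hemp
        exact hne (hsub.antisymm fun t ht => ⟨hemp ht, hDA ht⟩)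
      obtain ⟨a1, a2⟩ := aux hDA hA hA1 hA2
      obtain ⟨b1, b2⟩ := aux hDB hB hB1 hB2
      have := false_of_inter_subset hH hDA hDB hcut hA a1 a2 b1 b2
      have := false_of_inter_subset hH hDB hDA hcut' hB b1 b2 a1 a2
      tauto
    · have := false_of_not_inter_subset hG hH hDB hDA hAB.symm (fun x => (hU x).symm) hcut' hB
        hA1 hA2
      tauto
  · have := false_of_not_inter_subset hG hH hDA hDB hAB hU hcut hA hB1 hB2
    tauto

end addVertex

/-! ### The labels and the tree-edges of the split tree -/

namespace SplitTree

variable {V N : Type*} {G : SimpleGraph V} (ST : SplitTree G N)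

/-- The leaf of the split tree that corresponds to a vertex of `G`. -/
def vert (x : V) : N := ST.leaf x

/-- The vertices of `G` whose leaves are on the side of `a` of the tree-edge `ab`. -/
def side (b a : N) : Set V := {x | ST.vert x ∈ ST.branch b a}

/-- The vertices on the side of `a` of the tree-edge `ab` that are accessible from `b`; these are
the ones with neighbours on the side of `b`. -/
def frontier (b a : N) : Set V := {x ∈ ST.side b a | ST.Accessible (ST.vert x) b}

variable {ST}

theorem isLeaf_vert (x : V) : ST.IsLeaf (ST.vert x) := (ST.leaf x).2

theorem vert_injective : Function.Injective ST.vert := fun _ _ h =>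
  ST.leaf.injective (Subtype.ext h)

theorem exists_vert_eq {l : N} (hl : ST.IsLeaf l) : ∃ x, ST.vert x = l :=
  ⟨ST.leaf.symm ⟨l, hl⟩, by simp [vert]⟩

theorem adj_iff_accessible {x y : V} : G.Adj x y ↔ ST.Accessible (ST.vert x) (ST.vert y) :=
  ST.leaf.map_adj_iff.symm

theorem vert_ne_of_isNode {v : N} (hv : ST.IsNode v) (x : V) : ST.vert x ≠ v :=
  fun h => hv (h ▸ isLeaf_vert x)

theorem frontier_subset (b a : N) : ST.frontier b a ⊆ ST.side b a := fun _ h => h.1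

theorem mem_side_iff {a b : N} (hab : ST.tree.Adj a b) {x : V} :
    x ∈ ST.side b a ↔ x ∉ ST.side a b := GraphLabelledTree.mem_branch_iff hab

theorem adj_iff_of_mem_side {a b : N} (hab : ST.tree.Adj a b) {x y : V} (hx : x ∈ ST.side b a)
    (hy : y ∈ ST.side a b) : G.Adj x y ↔ x ∈ ST.frontier b a ∧ y ∈ ST.frontier a b := by
  rw [adj_iff_accessible (ST := ST), GraphLabelledTree.accessible_iff_of_adj hab hx hy]
  exact ⟨fun h => ⟨⟨hx, h.1⟩, hy, h.2⟩, fun h => ⟨h.1.2, h.2.2⟩⟩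

theorem adj_iff_of_mem_side_of_ne {v w w' : N} (hw : ST.tree.Adj v w) (hw' : ST.tree.Adj v w')
    (hne : w ≠ w') {x y : V} (hx : x ∈ ST.side v w) (hy : y ∈ ST.side v w') :
    G.Adj x y ↔ x ∈ ST.frontier v w ∧ y ∈ ST.frontier v w' ∧ ST.MarkersAdj v w w' := by
  rw [adj_iff_accessible (ST := ST),
    GraphLabelledTree.accessible_iff_of_mem_branch hw hw' hne hx hy]
  exact ⟨fun h => ⟨⟨hx, h.1⟩, ⟨hy, h.2.1⟩, h.2.2⟩, fun h => ⟨h.1.2, h.2.1.2, h.2.2⟩⟩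

theorem mem_frontier_iff {a b w : N} (hab : ST.tree.Adj a b) (hw : ST.tree.Adj a w) (hne : w ≠ b)
    {x : V} (hx : x ∈ ST.side a w) :
    x ∈ ST.frontier b a ↔ x ∈ ST.frontier a w ∧ ST.MarkersAdj a w b := by
  have := GraphLabelledTree.accessible_neighbor_iff hab hw hne hx
  exact ⟨fun h => ⟨⟨hx, (this.1 h.2).1⟩, (this.1 h.2).2⟩,
    fun h => ⟨GraphLabelledTree.branch_subset hab hw hne hx, this.2 ⟨h.1.2, h.2⟩⟩⟩

theorem exists_mem_side {v : N} (hv : ST.IsNode v) (x : V) :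
    ∃ w, ST.tree.Adj v w ∧ x ∈ ST.side v w :=
  GraphLabelledTree.exists_mem_branch (vert_ne_of_isNode hv x)

theorem exists_mem_side_of_mem_side {a b : N} (hab : ST.tree.Adj a b) (ha : ST.IsNode a) {x : V}
    (hx : x ∈ ST.side b a) : ∃ w, ST.tree.Adj a w ∧ w ≠ b ∧ x ∈ ST.side a w :=
  GraphLabelledTree.exists_mem_branch_of_mem_branch hab hx (vert_ne_of_isNode ha x)

theorem side_nonempty [Finite N] {a b : N} (hab : ST.tree.Adj a b) : (ST.side a b).Nonempty := by
  obtain ⟨l, hl, hleaf⟩ := GraphLabelledTree.exists_isLeaf_mem_branch hab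
  obtain ⟨x, rfl⟩ := exists_vert_eq hleaf
  exact ⟨x, hl⟩

theorem frontier_nonempty [Finite N] (hG : G.Connected) {a b : N} (hab : ST.tree.Adj a b) :
    (ST.frontier a b).Nonempty := by
  obtain ⟨x, hx⟩ := side_nonempty (ST := ST) hab
  obtain ⟨y, hy⟩ := side_nonempty (ST := ST) hab.symm
  obtain ⟨c, hc, d, hd, hcd⟩ := hG.exists_adj_boundary hx ((mem_side_iff hab).1 hy)
  exact ⟨c, ((adj_iff_of_mem_side hab.symm hc ((mem_side_iff hab).2 hd)).1 hcd).1⟩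

theorem label_connected [Finite N] (hG : G.Connected) {v : N} (hv : ST.IsNode v) :
    (ST.label v).Connected := by
  have hne : (ST.tree.neighborSet v).Nonempty := (Set.not_subsingleton_iff.1 hv).nonempty
  rw [connected_iff]
  refine ⟨fun w w' => ?_, hne.to_subtype⟩
  by_contra hww
  obtain ⟨x, hx⟩ := side_nonempty (ST := ST) w.2
  obtain ⟨y, hy⟩ := side_nonempty (ST := ST) w'.2
  let A : Set V := {x | ∃ c : ST.tree.neighborSet v, (ST.label v).Reachable w c ∧ x ∈ ST.side v c}
  have hyA : y ∉ A := by
    rintro ⟨c, hc, hyc⟩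
    rw [Subtype.ext (GraphLabelledTree.eq_of_mem_branch c.2 w'.2 hyc hy)] at hc
    exact hww hc
  obtain ⟨x', ⟨c, hc, hx'⟩, y', hy', hadj⟩ := hG.exists_adj_boundary (A := A) ⟨w, .refl _, hx⟩ hyA
  obtain ⟨d, hd, hyd⟩ := exists_mem_side hv y'
  have hcd : (c : N) ≠ d := by
    rintro rfl
    exact hy' ⟨c, hc, hyd⟩
  obtain ⟨_, _, hm⟩ := ((adj_iff_of_mem_side_of_ne c.2 hd hcd hx' hyd).1 hadj).2.2
  exact hy' ⟨⟨d, hd⟩, hc.trans hm.reachable, hyd⟩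

/-- The label of `v` embeds in `G`: each marker is sent to an accessible leaf of its branch. -/
theorem label_isDegenerateGraph [Finite N] (hG : G.Connected) (hDH : HasShortcuts G) {v : N}
    (hv : ST.IsNode v) : IsDegenerateGraph (ST.label v) := by
  choose g hg using fun w : ST.tree.neighborSet v => frontier_nonempty hG w.2
  have hinj : Function.Injective g := fun w w' h => Subtype.ext
    (GraphLabelledTree.eq_of_mem_branch w.2 w'.2 (hg w).1 (h ▸ (hg w').1))
  have hadj : ∀ {w w'}, G.Adj (g w) (g w') ↔ (ST.label v).Adj w w' := by
    intro w w'
    by_cases hne : w = w'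
    · simp [hne]
    · rw [adj_iff_of_mem_side_of_ne w.2 w'.2 (fun h => hne (Subtype.ext h)) (hg w).1 (hg w').1]
      exact ⟨fun h => h.2.2.2.2, fun h => ⟨hg w, hg w', w.2, w'.2, h⟩⟩
  exact (hDH.of_embedding ⟨⟨g, hinj⟩, hadj⟩).isDegenerateGraph (label_connected hG hv)
    (ST.prime_or_degenerate v hv)

theorem isCliqueNode_or_isStarNode [Finite N] (hG : G.Connected) (hDH : HasShortcuts G) {v : N}
    (hv : ST.IsNode v) : ST.IsCliqueNode v ∨ ∃ c, ST.IsStarNode v c :=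
  (label_isDegenerateGraph hG hDH hv).imp (⟨hv, ·⟩) fun ⟨c, hc⟩ => ⟨c, hv, hc⟩

theorem markersAdj_of_isCliqueNode {v w w' : N} (hv : ST.IsCliqueNode v) (hw : ST.tree.Adj v w)
    (hw' : ST.tree.Adj v w') (hne : w ≠ w') : ST.MarkersAdj v w w' :=
  ⟨hw, hw', hv.2 _ _ fun h => hne (congrArg Subtype.val h)⟩

theorem markersAdj_iff_of_isStarNode {v w w' : N} {c : ST.tree.neighborSet v}
    (hv : ST.IsStarNode v c) (hw : ST.tree.Adj v w) (hw' : ST.tree.Adj v w') (hne : w ≠ w') :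
    ST.MarkersAdj v w w' ↔ w = c ∨ w' = c := by
  constructor
  · rintro ⟨_, _, h⟩
    exact ((hv.2 _ _).1 h).2.imp (congrArg Subtype.val) (congrArg Subtype.val)
  · intro h
    exact ⟨hw, hw', (hv.2 _ _).2 ⟨fun h => hne (congrArg Subtype.val h),
      h.imp (Subtype.ext ·) (Subtype.ext ·)⟩⟩

theorem exists_adj_ne_ne [Finite N] {v : N} (hv : ST.IsNode v) (a b : N) :
    ∃ w, ST.tree.Adj v w ∧ w ≠ a ∧ w ≠ b := by
  have h := ST.reduced.1 v hv
  by_contra! hno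
  have hsub : ST.tree.neighborSet v ⊆ {a, b} := fun w hw => by
    by_cases h : w = a
    · exact Or.inl h
    · exact Or.inr (hno w hw h)
  have h1 := (Set.ncard_le_ncard hsub).trans (Set.ncard_insert_le a {b})
  rw [Set.ncard_singleton] at h1
  omega

/-- The common reason for clique nodes and for star nodes with centre towards the edge: two
accessible vertices in different branches at `a` are adjacent exactly if `c` holds, and there are
at least two such branches besides the one at `b`. -/
theorem joinSide_of_markersAdj_iff [Finite N] (hG : G.Connected) {a b : N} (hab : ST.tree.Adj a b)
    (ha : ST.IsNode a) {c : Prop} (hb : ∀ w, ST.tree.Adj a w → w ≠ b → ST.MarkersAdj a w b)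
    (hc : ∀ w w', ST.tree.Adj a w → ST.tree.Adj a w' → w ≠ b → w' ≠ b → w ≠ w' →
      (ST.MarkersAdj a w w' ↔ c)) :
    JoinSide G (ST.side b a) (ST.frontier b a) c := by
  have hfr : ∀ {x w}, ST.tree.Adj a w → w ≠ b → x ∈ ST.side a w →
      (x ∈ ST.frontier b a ↔ x ∈ ST.frontier a w) := fun {x w} hw hwb hx => by
    simp [mem_frontier_iff hab hw hwb hx, hb w hw hwb]
  have hadj : ∀ {x y w w'}, ST.tree.Adj a w → ST.tree.Adj a w' → w ≠ b → w' ≠ b → w ≠ w' →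
      x ∈ ST.frontier a w → y ∈ ST.frontier a w' → (G.Adj x y ↔ c) :=
    fun {x y w w'} hw hw' hwb hwb' hne hx hy => by
      rw [adj_iff_of_mem_side_of_ne hw hw' hne hx.1 hy.1, hc w w' hw hw' hwb hwb' hne]
      simp [hx, hy]
  refine ⟨fun P ⟨t, ht, htP⟩ ⟨t', ht', htP'⟩ => ?_, fun s ⟨hs, hsD⟩ d hd hsd => ?_⟩
  · obtain ⟨w, hw, hwb, htw⟩ := exists_mem_side_of_mem_side hab ha ht.1
    obtain ⟨w', hw', hwb', htw'⟩ := exists_mem_side_of_mem_side hab ha ht'.1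
    by_cases hne : w = w'
    · subst hne
      obtain ⟨w', hw', hwb', hne⟩ := exists_adj_ne_ne ha b w
      obtain ⟨r, hr⟩ := frontier_nonempty hG hw'
      have hrD := (hfr hw' hwb' hr.1).2 hr
      by_cases hrP : r ∈ P
      · exact ⟨r, ⟨hrD, hrP⟩, t', ⟨ht', htP'⟩,
          hadj hw' hw hwb' hwb hne hr ((hfr hw hwb htw').1 ht')⟩
      · exact ⟨t, ⟨ht, htP⟩, r, ⟨hrD, hrP⟩,
          hadj hw hw' hwb hwb' hne.symm ((hfr hw hwb htw).1 ht) hr⟩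
    · exact ⟨t, ⟨ht, htP⟩, t', ⟨ht', htP'⟩, hadj hw hw' hwb hwb' hne ((hfr hw hwb htw).1 ht)
        ((hfr hw' hwb' htw').1 ht')⟩
  · obtain ⟨w, hw, hwb, hsw⟩ := exists_mem_side_of_mem_side hab ha hs
    obtain ⟨w₁, hw₁, hwb₁, hdw⟩ := exists_mem_side_of_mem_side hab ha hd.1
    have hsw' : s ∉ ST.frontier a w := fun h => hsD ((hfr hw hwb hsw).2 h)
    obtain rfl : w = w₁ := by
      by_contra hne
      exact hsw' ((adj_iff_of_mem_side_of_ne hw hw₁ hne hsw hdw).1 hsd).1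
    obtain ⟨w', hw', hwb', hne⟩ := exists_adj_ne_ne ha b w
    obtain ⟨r, hr⟩ := frontier_nonempty hG hw'
    exact ⟨r, (hfr hw' hwb' hr.1).2 hr,
      hadj hw hw' hwb hwb' hne.symm ((hfr hw hwb hdw).1 hd) hr,
      fun h => hsw' ((adj_iff_of_mem_side_of_ne hw hw' hne.symm hsw hr.1).1 h).1⟩

theorem joinSide_of_isCliqueNode [Finite N] (hG : G.Connected) {a b : N} (hab : ST.tree.Adj a b)
    (ha : ST.IsCliqueNode a) : JoinSide G (ST.side b a) (ST.frontier b a) True :=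
  joinSide_of_markersAdj_iff hG hab ha.1 (fun _ hw hwb => markersAdj_of_isCliqueNode ha hw hab hwb)
    fun _ _ hw hw' _ _ hne => iff_true_intro (markersAdj_of_isCliqueNode ha hw hw' hne)

theorem joinSide_of_isStarNode [Finite N] (hG : G.Connected) {a b : N} (hab : ST.tree.Adj a b)
    {c : ST.tree.neighborSet a} (ha : ST.IsStarNode a c) (hc : (c : N) = b) :
    JoinSide G (ST.side b a) (ST.frontier b a) False := by
  refine joinSide_of_markersAdj_iff hG hab ha.1
    (fun _ hw hwb => (markersAdj_iff_of_isStarNode ha hw hab hwb).2 (Or.inr hc.symm))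
    fun _ _ hw hw' hwb hwb' hne => ?_
  rw [markersAdj_iff_of_isStarNode ha hw hw' hne, hc]
  tauto

theorem pendantSide_of_isStarNode [Finite N] (hG : G.Connected) {a b : N} (hab : ST.tree.Adj a b)
    {c : ST.tree.neighborSet a} (ha : ST.IsStarNode a c) (hc : (c : N) ≠ b) :
    PendantSide G (ST.side b a) (ST.frontier b a) := by
  obtain ⟨w, hw, hwb, hwc⟩ := exists_adj_ne_ne ha.1 b c
  obtain ⟨y, hy⟩ := frontier_nonempty hG hw
  refine ⟨y, ⟨GraphLabelledTree.branch_subset hab hw hwb hy.1, fun h => ?_⟩, fun d hd => ?_⟩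
  · rw [mem_frontier_iff hab hw hwb hy.1, markersAdj_iff_of_isStarNode ha hw hab hwb] at h
    exact h.2.elim hwc fun h => hc h.symm
  · obtain ⟨w', hw', hwb', hd'⟩ := exists_mem_side_of_mem_side hab ha.1 hd.1
    rw [mem_frontier_iff hab hw' hwb' hd', markersAdj_iff_of_isStarNode ha hw' hab hwb'] at hd
    obtain rfl := hd.2.resolve_right fun h => hc h.symm
    rw [adj_iff_of_mem_side_of_ne hw c.2 hwc hy.1 hd']
    exact ⟨hy, hd.1, (markersAdj_iff_of_isStarNode ha hw c.2 hwc).2 (Or.inr rfl)⟩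

/-- The side of `a` of the tree-edge `ab` is good for `S`: `S` contains none of its vertices, or
exactly those accessible from `b`. -/
def IsGood (S : Set V) (b a : N) : Prop := S ∩ ST.side b a = ∅ ∨ S ∩ ST.side b a = ST.frontier b a

theorem isGood_of_isLeaf {S : Set V} {a b : N} (hab : ST.tree.Adj a b) (ha : ST.IsLeaf a) :
    ST.IsGood S b a := by
  obtain ⟨x, rfl⟩ := exists_vert_eq ha
  have h1 : ST.side b (ST.vert x) = {x} := by
    ext y
    exact ⟨fun h => vert_injective (GraphLabelledTree.eq_of_isLeaf_of_mem_branch hab ha h),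
      by rintro rfl; exact GraphLabelledTree.self_mem_branch hab.symm⟩
  have h2 : ST.frontier b (ST.vert x) = {x} := by
    rw [frontier, h1]
    ext y
    simp only [Set.mem_ofPred_eq, Set.mem_singleton_iff, and_iff_left_iff_imp]
    rintro rfl
    exact GraphLabelledTree.accessible_of_adj hab
  rw [IsGood, h1, h2]
  by_cases hx : x ∈ S <;> simp [hx]

theorem isGood_or_isGood [Finite N] (hG : G.Connected) (hDH : HasShortcuts G) {S : Set V}
    (hH : HasShortcuts (addVertex G S)) {a b : N} (hab : ST.tree.Adj a b) :
    ST.IsGood S b a ∨ ST.IsGood S a b := by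
  by_cases ha : ST.IsLeaf a
  · exact Or.inl (isGood_of_isLeaf hab ha)
  by_cases hb : ST.IsLeaf b
  · exact Or.inr (isGood_of_isLeaf hab.symm hb)
  refine inter_eq_of_addVertex_hasShortcuts hG hH (frontier_subset b a) (frontier_subset a b)
    (Set.disjoint_left.2 fun x hx => (mem_side_iff hab).1 hx)
    (fun x => (em (x ∈ ST.side b a)).imp_right (mem_side_iff hab.symm).2)
    (fun x hx y hy => adj_iff_of_mem_side hab hx hy) ?_
  have hK := ST.reduced.2.1 a b
  rcases isCliqueNode_or_isStarNode hG hDH ha with ha' | ⟨c, hc⟩ <;>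
    rcases isCliqueNode_or_isStarNode hG hDH hb with hb' | ⟨d, hd⟩
  · exact absurd ⟨hab, ha', hb'⟩ hK
  · have h1 := joinSide_of_isCliqueNode hG hab ha'
    by_cases hda : (d : N) = a
    · have := joinSide_of_isStarNode hG hab.symm hd hda
      tauto
    · have := pendantSide_of_isStarNode hG hab.symm hd hda
      tauto
  · have h1 := joinSide_of_isCliqueNode hG hab.symm hb'
    by_cases hcb : (c : N) = b
    · have := joinSide_of_isStarNode hG hab hc hcb
      tauto
    · have := pendantSide_of_isStarNode hG hab hc hcb
      tauto
  · by_cases hda : (d : N) = a <;> by_cases hcb : (c : N) = b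
    · have := joinSide_of_isStarNode hG hab hc hcb
      have := joinSide_of_isStarNode hG hab.symm hd hda
      tauto
    · exact absurd ⟨d, c, hab.symm, hd, hc, hda, hcb⟩ (ST.reduced.2.2 b a)
    · exact absurd ⟨c, d, hab, hc, hd, hcb, hda⟩ (ST.reduced.2.2 a b)
    · have := pendantSide_of_isStarNode hG hab hc hcb
      have := pendantSide_of_isStarNode hG hab.symm hd hda
      tauto

end SplitTree

/-! ### A tree-vertex all of whose branches are good -/

namespace SplitTree

variable {V N : Type*} {G : SimpleGraph V} {ST : SplitTree G N} {S : Set V}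

theorem mem_hitNeighbors_iff {v w : N} :
    w ∈ ST.hitNeighbors (ST.leaves S) v ↔ ST.tree.Adj v w ∧ (S ∩ ST.side v w).Nonempty := by
  refine and_congr_right fun _ => ⟨?_, ?_⟩
  · rintro ⟨_, ⟨x, hx, rfl⟩, h⟩
    exact ⟨x, hx, h⟩
  · rintro ⟨x, hx, h⟩
    exact ⟨_, ⟨x, hx, rfl⟩, h⟩

theorem ncard_branch_lt [Finite N] {a b w : N} (hab : ST.tree.Adj a b) (hw : ST.tree.Adj b w)
    (hne : w ≠ a) : (ST.branch b w).ncard < (ST.branch a b).ncard :=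
  Set.ncard_lt_ncard ⟨GraphLabelledTree.branch_subset hab.symm hw hne, fun h =>
    GraphLabelledTree.notMem_branch b w (h (GraphLabelledTree.self_mem_branch hab))⟩

/-- Starting from a tree-edge `ab` whose side at `a` is good and whose side at `b` meets `S`, move
into a bad branch at `b`, or into the only branch at `b` that meets `S`. The edge entered has
again a good side behind it, so the process stops at a node as required. -/
theorem exists_forall_isGood_of_isGood [Finite N] (hG : G.Connected) (hDH : HasShortcuts G)
    (hH : HasShortcuts (addVertex G S)) (hS : S.Nontrivial) {a b : N} (hab : ST.tree.Adj a b)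
    (hb : ST.IsNode b) (hgood : ST.IsGood S b a) (hhit : (S ∩ ST.side a b).Nonempty) :
    ∃ u, ST.IsNode u ∧ (∀ w, ST.tree.Adj u w → ST.IsGood S u w) ∧
      ∃ w ∈ ST.hitNeighbors (ST.leaves S) u, ∃ w' ∈ ST.hitNeighbors (ST.leaves S) u, w ≠ w' := by
  induction hn : (ST.branch a b).ncard using Nat.strong_induction_on generalizing a b with
  | _ n ih =>
    subst hn
    by_cases hall : ∀ w, ST.tree.Adj b w → w ≠ a → ST.IsGood S b w
    · obtain ⟨x, hxS, hx⟩ := hhit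
      obtain ⟨w, hw, hwa, hxw⟩ := exists_mem_side_of_mem_side hab.symm hb hx
      by_cases hother : ∃ w' ∈ ST.hitNeighbors (ST.leaves S) b, w ≠ w'
      · refine ⟨b, hb, fun v hv => ?_, w, mem_hitNeighbors_iff.2 ⟨hw, x, hxS, hxw⟩, hother⟩
        by_cases hva : v = a
        · exact hva ▸ hgood
        · exact hall v hv hva
      · have hsub : S ⊆ ST.side b w := by
          intro y hy
          obtain ⟨w', hw', hyw'⟩ := exists_mem_side hb y
          by_contra hyw
          exact hother ⟨w', mem_hitNeighbors_iff.2 ⟨hw', y, hy, hyw'⟩, fun h => hyw (h ▸ hyw')⟩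
        refine ih _ (ncard_branch_lt hab hw hwa) hw (fun hleaf => ?_) (Or.inl ?_) ⟨x, hxS, hxw⟩ rfl
        · obtain ⟨y, hy, hyx⟩ := hS.exists_ne x
          exact hyx (vert_injective ((GraphLabelledTree.eq_of_isLeaf_of_mem_branch hw.symm hleaf
            (hsub hy)).trans (GraphLabelledTree.eq_of_isLeaf_of_mem_branch hw.symm hleaf hxw).symm))
        · ext y
          simp only [Set.mem_inter_iff, Set.mem_empty_iff_false, iff_false, not_and]
          exact fun hy => (mem_side_iff hw.symm).1 (hsub hy)
    · push Not at hall
      obtain ⟨w, hw, hwa, hbad⟩ := hall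
      refine ih _ (ncard_branch_lt hab hw hwa) hw
        (fun hleaf => hbad (isGood_of_isLeaf hw.symm hleaf))
        ((isGood_or_isGood hG hDH hH hw).resolve_right hbad) ?_ rfl
      exact Set.nonempty_iff_ne_empty.2 fun h => hbad (Or.inl h)

/-- The second alternative is the tree with two leaves and no node. -/
theorem exists_forall_isGood [Finite N] (hG : G.Connected) (hDH : HasShortcuts G)
    (hH : HasShortcuts (addVertex G S)) (hS : S.Nontrivial) :
    (∃ u, ST.IsNode u ∧ (∀ w, ST.tree.Adj u w → ST.IsGood S u w) ∧
      ∃ w ∈ ST.hitNeighbors (ST.leaves S) u, ∃ w' ∈ ST.hitNeighbors (ST.leaves S) u, w ≠ w') ∨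
    ∃ a b, ST.tree.Adj a b ∧ ST.IsLeaf a ∧ ST.IsLeaf b := by
  obtain ⟨s, hs, t, ht, hst⟩ := hS
  obtain ⟨b, hb, htb⟩ := GraphLabelledTree.exists_mem_branch (T := ST.toGraphLabelledTree)
    (fun h : ST.vert t = ST.vert s => hst (vert_injective h).symm)
  by_cases hleaf : ST.IsLeaf b
  · exact Or.inr ⟨_, b, hb, isLeaf_vert s, hleaf⟩
  · exact Or.inl (exists_forall_isGood_of_isGood hG hDH hH ⟨s, hs, t, ht, hst⟩ hb hleaf
      (isGood_of_isLeaf hb (isLeaf_vert s)) ⟨t, ht, htb⟩)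

theorem exists_cut_of_isGood [Finite N] (hG : G.Connected) {u w : N} (hw : ST.tree.Adj u w)
    (hgood : ST.IsGood S u w) : ∃ α β : Option V → Prop,
      ∀ a ∈ some '' ST.side u w, ∀ b ∉ some '' ST.side u w,
        ((addVertex G S).Adj a b ↔ α a ∧ β b) := by
  refine ⟨fun o => ∃ y ∈ ST.frontier u w, o = some y, fun o => (∃ z ∈ ST.frontier w u, o = some z) ∨
    o = none ∧ S ∩ ST.side u w = ST.frontier u w, ?_⟩
  rintro _ ⟨y, hy, rfl⟩ b hb
  rcases b with - | z
  · simp only [addVertex_some_none, Option.some.injEq, exists_eq_right', reduceCtorEq, and_false,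
      exists_false, true_and, false_or]
    rcases hgood with h | h
    · have h1 : y ∉ S := fun hyS => (Set.eq_empty_iff_forall_notMem.1 h y) ⟨hyS, hy⟩
      simp [h1, h, (frontier_nonempty hG hw).ne_empty.symm]
    · rw [← h]
      simp [hy]
  · have hz : z ∈ ST.side w u := (mem_side_iff hw).2 fun h => hb ⟨z, h, rfl⟩
    rw [addVertex_some_some, adj_iff_of_mem_side hw.symm hy hz]
    simp

/-- If all branches at some tree-vertex are good, the new vertex can be added. -/
theorem addVertex_hasShortcuts_of_forall_isGood [Finite N] (hG : G.Connected)
    (hDH : HasShortcuts G) {u : N} (hu : ∀ w, ST.tree.Adj u w → ST.IsGood S u w) :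
    HasShortcuts (addVertex G S) := by
  by_contra hH
  obtain ⟨k, q, e, ho⟩ := exists_isObstruction hH
  have hmap : ∀ y₀ : V, ¬ ∀ a ∈ obstructionVerts k q e, ∀ b ∈ obstructionVerts k q e,
      ((addVertex G S).Adj a b ↔ G.Adj (a.getD y₀) (b.getD y₀)) := fun y₀ h =>
    (ho.map (fun o => o.getD y₀) h).not_hasShortcuts hDH
  have hnone : none ∈ obstructionVerts k q e := by
    by_contra hnone
    obtain ⟨y₀⟩ := hG.nonempty
    refine hmap y₀ fun a ha b hb => ?_
    rcases a with - | a
    · exact absurd ha hnone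
    rcases b with - | b
    · exact absurd hb hnone
    exact Iff.rfl
  have hsub : ∀ w, ST.tree.Adj u w → ∀ x ∈ ST.side u w, ∀ y ∈ ST.side u w,
      some x ∈ obstructionVerts k q e → some y ∈ obstructionVerts k q e → x = y := by
    intro w hw x hx y hy hxY hyY
    by_contra hxy
    obtain ⟨α, β, hcut⟩ := exists_cut_of_isGood hG hw (hu w hw)
    have hone : ∀ z, some z ∈ obstructionVerts k q e → z ∈ ST.side u w := by
      intro z hz
      by_contra hzw
      exact ho.false_of_cut hcut
        ⟨some x, ⟨hxY, x, hx, rfl⟩, some y, ⟨hyY, y, hy, rfl⟩, by simpa using hxy⟩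
        ⟨some z, ⟨hz, by simpa using hzw⟩, none, ⟨hnone, by simp⟩, by simp⟩
    -- a vertex of `G` beyond `w` with the same neighbours as the new vertex in the branch of `w`
    obtain ⟨y₀, hy₀⟩ := frontier_nonempty (ST := ST) hG hw.symm
    have hS : ∀ z, some z ∈ obstructionVerts k q e → (z ∈ S ↔ G.Adj y₀ z) := by
      intro z hz
      have hzw := hone z hz
      rw [adj_iff_of_mem_side hw hy₀.1 hzw, and_iff_right hy₀]
      rcases hu w hw with h | h
      · obtain ⟨b, hb, hadj⟩ := ho.exists_adj hnone
        rcases b with - | b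
        · exact absurd rfl hadj.ne
        · exact absurd (h ▸ ⟨hadj, hone b hb⟩ : b ∈ (∅ : Set V)) (Set.notMem_empty b)
      · rw [← h]
        exact (and_iff_left hzw).symm
    refine hmap y₀ fun a ha b hb => ?_
    rcases a with - | a <;> rcases b with - | b
    · simp
    · exact hS b hb
    · exact (hS a ha).trans (G.adj_comm _ _)
    · exact Iff.rfl
  by_cases hleaf : ST.IsLeaf u
  · obtain ⟨t, rfl⟩ := exists_vert_eq hleaf
    obtain ⟨x, hx, y, hy, z, hz, hxn, hyn, hzn, hxz, hxy, hyz, -⟩ := ho.exists_path_three none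
    obtain ⟨x, rfl⟩ := Option.ne_none_iff_exists'.1 hxn
    obtain ⟨y, rfl⟩ := Option.ne_none_iff_exists'.1 hyn
    obtain ⟨z, rfl⟩ := Option.ne_none_iff_exists'.1 hzn
    have key : ∀ x y, some x ∈ obstructionVerts k q e → some y ∈ obstructionVerts k q e →
        x ≠ y → x = t ∨ y = t := by
      intro x y hx hy hxy
      by_contra! h
      obtain ⟨w, hw, hxw⟩ := GraphLabelledTree.exists_mem_branch (T := ST.toGraphLabelledTree)
        (fun h' : ST.vert x = ST.vert t => h.1 (vert_injective h'))
      obtain ⟨w', hw', hyw⟩ := GraphLabelledTree.exists_mem_branch (T := ST.toGraphLabelledTree)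
        (fun h' : ST.vert y = ST.vert t => h.2 (vert_injective h'))
      obtain rfl := hleaf hw hw'
      exact hxy (hsub w hw x hxw y hyw hx hy)
    have h1 : x ≠ y := fun h => hxy.ne (congrArg some h)
    have h2 : y ≠ z := fun h => hyz.ne (congrArg some h)
    have h3 : x ≠ z := fun h => hxz (congrArg some h)
    have := key x y hx hy h1
    have := key y z hy hz h2
    have := key x z hx hz h3
    grind
  · have hadj : ∀ x y w w', some x ∈ obstructionVerts k q e → some y ∈ obstructionVerts k q e →
        ST.tree.Adj u w → ST.tree.Adj u w' → x ∈ ST.side u w → y ∈ ST.side u w' → x ≠ y →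
        w ≠ w' ∧ (G.Adj x y ↔ x ∈ ST.frontier u w ∧ y ∈ ST.frontier u w' ∧
          ST.MarkersAdj u w w') := by
      intro x y w w' hx hy hw hw' hxw hyw hxy
      have hne : w ≠ w' := by
        rintro rfl
        exact hxy (hsub w hw x hxw y hyw hx hy)
      exact ⟨hne, adj_iff_of_mem_side_of_ne hw hw' hne hxw hyw⟩
    rcases isCliqueNode_or_isStarNode hG hDH hleaf with hc | ⟨c, hc⟩
    · obtain ⟨x, hx, y, hy, z, hz, hxn, hyn, hzn, hxz, hxy, hyz, hnxz⟩ := ho.exists_path_three none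
      obtain ⟨x, rfl⟩ := Option.ne_none_iff_exists'.1 hxn
      obtain ⟨y, rfl⟩ := Option.ne_none_iff_exists'.1 hyn
      obtain ⟨z, rfl⟩ := Option.ne_none_iff_exists'.1 hzn
      rw [addVertex_some_some] at hxy hyz hnxz
      obtain ⟨wx, hwx, hxw⟩ := exists_mem_side hleaf x
      obtain ⟨wy, hwy, hyw⟩ := exists_mem_side hleaf y
      obtain ⟨wz, hwz, hzw⟩ := exists_mem_side hleaf z
      have e1 := ((hadj x y wx wy hx hy hwx hwy hxw hyw hxy.ne).2.1 hxy).1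
      have e2 := ((hadj y z wy wz hy hz hwy hwz hyw hzw hyz.ne).2.1 hyz).2.1
      have e3 := hadj x z wx wz hx hz hwx hwz hxw hzw (fun h => hxz (congrArg some h))
      exact hnxz (e3.2.2 ⟨e1, e2, markersAdj_of_isCliqueNode hc hwx hwz e3.1⟩)
    · have key : ∀ a b, a ∈ obstructionVerts k q e → b ∈ obstructionVerts k q e → a ≠ none →
          b ≠ none → (addVertex G S).Adj a b →
          ∃ x, some x ∈ obstructionVerts k q e ∧ (some x = a ∨ some x = b) ∧ x ∈ ST.side u c := by
        intro x y hx hy hxn hyn hxy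
        obtain ⟨x, rfl⟩ := Option.ne_none_iff_exists'.1 hxn
        obtain ⟨y, rfl⟩ := Option.ne_none_iff_exists'.1 hyn
        rw [addVertex_some_some] at hxy
        obtain ⟨w, hw, hxw⟩ := exists_mem_side hleaf x
        obtain ⟨w', hw', hyw⟩ := exists_mem_side hleaf y
        have e1 := hadj x y w w' hx hy hw hw' hxw hyw hxy.ne
        rcases (markersAdj_iff_of_isStarNode hc hw hw' e1.1).1 (e1.2.1 hxy).2.2 with h | h
        · exact ⟨x, hx, Or.inl rfl, h ▸ hxw⟩
        · exact ⟨y, hy, Or.inr rfl, h ▸ hyw⟩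
      obtain ⟨a, ha, b, hb, c', hc', d, hd, ⟨n1, n2, n3, n4⟩, ⟨m1, m2, m3, m4⟩, hab, hcd⟩ :=
        ho.exists_two_edges none
      obtain ⟨x, hx, hx1, hx2⟩ := key a b ha hb n1 n2 hab
      obtain ⟨y, hy, hy1, hy2⟩ := key c' d hc' hd n3 n4 hcd
      obtain rfl := hsub c c.2 x hx2 y hy2 hx hy
      grind

/-! ### Good branches and accessibility conditions -/

theorem notMem_leaves_of_isNode {v : N} (hv : ST.IsNode v) : v ∉ ST.leaves S := by
  rintro ⟨x, -, h⟩
  exact vert_ne_of_isNode hv x h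

theorem IsGood.eq_frontier {b a : N} (h : ST.IsGood S b a) (hS : (S ∩ ST.side b a).Nonempty) :
    S ∩ ST.side b a = ST.frontier b a := h.resolve_left hS.ne_empty

theorem centre_unique [Finite N] {v : N} {c c' : ST.tree.neighborSet v} (h : ST.IsStarNode v c)
    (h' : ST.IsStarNode v c') : c = c' := by
  by_contra hne
  obtain ⟨w, hw, hwc, hwc'⟩ := exists_adj_ne_ne h.1 (c : N) c'
  have h1 := (markersAdj_iff_of_isStarNode h hw c.2 hwc).2 (Or.inr rfl)
  rcases (markersAdj_iff_of_isStarNode h' hw c.2 hwc).1 h1 with h2 | h2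
  · exact hwc' h2
  · exact hne (Subtype.ext h2)

theorem not_isStarNode_of_isCliqueNode [Finite N] {v : N} (hv : ST.IsCliqueNode v)
    (c : ST.tree.neighborSet v) : ¬ ST.IsStarNode v c := by
  intro h
  obtain ⟨w, hw, hwc, -⟩ := exists_adj_ne_ne hv.1 (c : N) c
  obtain ⟨w', hw', hwc', hne⟩ := exists_adj_ne_ne hv.1 (c : N) w
  have := (markersAdj_iff_of_isStarNode h hw' hw hne).1 (markersAdj_of_isCliqueNode hv hw' hw hne)
  tauto

/-- A clique node has degree at least three, so it is not a star node and not singly accessible.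
-/
theorem fullyAccessible_or_partiallyAccessible_of_isCliqueNode [Finite N] {v : N}
    (hv : ST.IsNodeOfSpan (ST.leaves S) v) (hc : ST.IsCliqueNode v) :
    ST.FullyAccessible (ST.leaves S) v ∨ ST.PartiallyAccessible (ST.leaves S) v := by
  by_cases h : ST.FullyAccessible (ST.leaves S) v
  · exact Or.inl h
  · exact Or.inr ⟨hv, h, fun ⟨_, c, hs, _⟩ => not_isStarNode_of_isCliqueNode hc c hs⟩

/-- If all branches at `u` are good, the branches at `v` that meet `S` are the one containing `u`
and those whose marker is adjacent to the marker towards `u`. -/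
theorem mem_hitNeighbors_iff_of_forall_isGood [Finite N] (hG : G.Connected) {u v q : N}
    (hu : ∀ w, ST.tree.Adj u w → ST.IsGood S u w)
    (huS : u ∈ ST.span (ST.leaves S)) (hunode : ST.IsNode u)
    (hv : ST.IsNodeOfSpan (ST.leaves S) v) (hvu : v ≠ u) (hq : ST.tree.Adj v q)
    (huq : u ∈ ST.branch v q) (z : N) :
    z ∈ ST.hitNeighbors (ST.leaves S) v ↔ ST.tree.Adj v z ∧ (z = q ∨ ST.MarkersAdj v z q) := by
  obtain ⟨w, hw, hvw⟩ := GraphLabelledTree.exists_mem_branch hvu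
  have hsub : ∀ {z}, ST.tree.Adj v z → z ≠ q → ST.side v z ⊆ ST.side u w := fun hz hzq _ hx =>
    GraphLabelledTree.branch_subset_of_mem_branch hq hz hzq huq hvw hx
  obtain ⟨z₀, hz₀, hz₀q⟩ := GraphLabelledTree.exists_ne_hitNeighbors_of_mem_span hv.2
    (notMem_leaves_of_isNode hv.1) q
  obtain ⟨hz₀, x, hxS, hx⟩ := mem_hitNeighbors_iff.1 hz₀
  have heq := (hu w hw).eq_frontier ⟨x, hxS, hsub hz₀ hz₀q hx⟩
  have hS : ∀ {z y}, ST.tree.Adj v z → z ≠ q → y ∈ ST.side v z → (y ∈ S ↔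
      y ∈ ST.frontier v z ∧ ST.Accessible u v ∧ ST.MarkersAdj v z q) := by
    intro z y hz hzq hy
    have h1 : y ∈ S ↔ ST.Accessible (ST.vert y) u :=
      ⟨fun h => (heq.subset ⟨h, hsub hz hzq hy⟩).2,
        fun h => (heq.superset ⟨hsub hz hzq hy, h⟩).1⟩
    rw [h1, GraphLabelledTree.accessible_iff_of_mem_branch hz hq hzq hy huq]
    exact ⟨fun h => ⟨⟨hy, h.1⟩, h.2⟩, fun h => ⟨h.1.2, h.2⟩⟩
  have huv := ((hS hz₀ hz₀q hx).1 hxS).2.1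
  by_cases hzq : z = q
  · subst hzq
    simp only [hq, true_or, and_self, iff_true]
    obtain ⟨w', hw', hne⟩ := GraphLabelledTree.exists_ne_hitNeighbors_of_mem_span huS
      (notMem_leaves_of_isNode hunode) w
    obtain ⟨hw', y, hyS, hy⟩ := mem_hitNeighbors_iff.1 hw'
    exact mem_hitNeighbors_iff.2 ⟨hq, y, hyS,
      GraphLabelledTree.branch_subset_of_mem_branch hw hw' hne hvw huq hy⟩
  · rw [mem_hitNeighbors_iff]
    refine and_congr_right fun hz => ?_
    simp only [hzq, false_or]
    constructor
    · rintro ⟨y, hyS, hy⟩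
      exact ((hS hz hzq hy).1 hyS).2.2
    · intro hm
      obtain ⟨y, hy⟩ := frontier_nonempty (ST := ST) hG hz
      exact ⟨y, (hS hz hzq hy.1).2 ⟨hy, huv, hm⟩, hy.1⟩

theorem orientedTowards_iff_fullyAccessible_of_forall_isGood [Finite N] (hG : G.Connected)
    {u v : N} (hu : ∀ w, ST.tree.Adj u w → ST.IsGood S u w) (huS : u ∈ ST.span (ST.leaves S))
    (hunode : ST.IsNode u) (hv : ST.IsNodeOfSpan (ST.leaves S) v) (hvu : v ≠ u)
    {c : ST.tree.neighborSet v} (hc : ST.IsStarNode v c) :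
    ST.OrientedTowards v c u ↔ ST.FullyAccessible (ST.leaves S) v := by
  obtain ⟨q, hq, huq⟩ := GraphLabelledTree.exists_mem_branch hvu.symm
  have hit := mem_hitNeighbors_iff_of_forall_isGood hG hu huS hunode hv hvu hq huq
  rw [GraphLabelledTree.orientedTowards_iff c.2]
  constructor
  · intro huc
    obtain rfl := GraphLabelledTree.eq_of_mem_branch hq c.2 huq huc
    refine ⟨hv, fun z hz => (hit z).2 ⟨hz, ?_⟩⟩
    by_cases hzc : z = c
    · exact Or.inl hzc
    · exact Or.inr ((markersAdj_iff_of_isStarNode hc hz hq hzc).2 (Or.inr rfl))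
  · intro hf
    obtain ⟨z, hz, hzq, hzc⟩ := exists_adj_ne_ne hv.1 q c
    rcases ((hit z).1 (hf.2 z hz)).2 with h | h
    · exact absurd h hzq
    · rcases (markersAdj_iff_of_isStarNode hc hz hq hzq).1 h with h | h
      · exact absurd h hzc
      · exact h ▸ huq

theorem not_partiallyAccessible_of_forall_isGood [Finite N] (hG : G.Connected)
    (hDH : HasShortcuts G) {u v : N} (hu : ∀ w, ST.tree.Adj u w → ST.IsGood S u w)
    (huS : u ∈ ST.span (ST.leaves S)) (hunode : ST.IsNode u) (hvu : v ≠ u) :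
    ¬ ST.PartiallyAccessible (ST.leaves S) v := by
  rintro ⟨hv, hnf, hns⟩
  obtain ⟨q, hq, huq⟩ := GraphLabelledTree.exists_mem_branch hvu.symm
  have hit := mem_hitNeighbors_iff_of_forall_isGood hG hu huS hunode hv hvu hq huq
  rcases isCliqueNode_or_isStarNode hG hDH hv.1 with hc | ⟨c, hc⟩
  · refine hnf ⟨hv, fun z hz => (hit z).2 ⟨hz, ?_⟩⟩
    by_cases hzq : z = q
    · exact Or.inl hzq
    · exact Or.inr (markersAdj_of_isCliqueNode hc hz hq hzq)
  · have hqc : q ≠ c := by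
      rintro rfl
      exact hnf ((orientedTowards_iff_fullyAccessible_of_forall_isGood hG hu huS hunode hv hvu
        hc).1 ((GraphLabelledTree.orientedTowards_iff c.2).2 huq))
    have heq : ST.hitNeighbors (ST.leaves S) v = {q, (c : N)} := by
      ext z
      rw [hit z]
      constructor
      · rintro ⟨hz, rfl | hm⟩
        · exact Or.inl rfl
        · by_cases hzq : z = q
          · exact Or.inl hzq
          · exact Or.inr (((markersAdj_iff_of_isStarNode hc hz hq hzq).1 hm).resolve_right hqc)
      · rintro (rfl | rfl)
        · exact ⟨hq, Or.inl rfl⟩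
        · exact ⟨c.2, Or.inr ((markersAdj_iff_of_isStarNode hc c.2 hq hqc.symm).2 (Or.inl rfl))⟩
    exact hns ⟨hv, c, hc, by rw [heq, Set.ncard_pair hqc], by simp [heq]⟩

/-- The edge joins `u` to a branch that meets `S`: the one at the centre if `u` is a fully
accessible star node, one at an extremity if `u` is singly accessible, any one if `u` is a clique
node. -/
theorem exists_edge_of_forall_isGood [Finite N] (hG : G.Connected)
    (hDH : HasShortcuts G) {u : N} (hu : ∀ w, ST.tree.Adj u w → ST.IsGood S u w)
    (huS : u ∈ ST.span (ST.leaves S)) (hunode : ST.IsNode u)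
    (hnp : ¬ ST.PartiallyAccessible (ST.leaves S) u) :
    ∃ a b : N, ST.tree.Adj a b ∧ a ∈ ST.span (ST.leaves S) ∧ b ∈ ST.span (ST.leaves S) ∧
      ∀ (v : N) (c : ST.tree.neighborSet v), ST.IsNodeOfSpan (ST.leaves S) v →
        ST.IsStarNode v c →
        (ST.OrientedTowardsEdge v c a b ↔ ST.FullyAccessible (ST.leaves S) v) := by
  have hnS : u ∉ ST.leaves S := notMem_leaves_of_isNode hunode
  -- it suffices to choose the edge `uw` so that the condition holds at `u` itself
  suffices h : ∃ w ∈ ST.hitNeighbors (ST.leaves S) u, ∀ c, ST.IsStarNode u c →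
      (w = c ↔ ST.FullyAccessible (ST.leaves S) u) by
    obtain ⟨w, hw, hwc⟩ := h
    obtain ⟨w', hw', hne⟩ := GraphLabelledTree.exists_ne_hitNeighbors_of_mem_span huS hnS w
    refine ⟨w, u, hw.1.symm, GraphLabelledTree.neighbor_mem_span_of_hitNeighbors hw hw' hne.symm,
      huS, fun v c hv hc => ?_⟩
    by_cases hvu : v = u
    · subst hvu
      rw [← hwc c hc, GraphLabelledTree.OrientedTowardsEdge,
        GraphLabelledTree.orientedTowards_iff c.2, GraphLabelledTree.orientedTowards_iff c.2,
        or_iff_left (GraphLabelledTree.notMem_branch _ _)]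
      exact ⟨fun h => GraphLabelledTree.eq_of_mem_branch hw.1 c.2
        (GraphLabelledTree.self_mem_branch hw.1) h,
        fun h => h ▸ GraphLabelledTree.self_mem_branch hw.1⟩
    · rw [GraphLabelledTree.orientedTowardsEdge_iff c.2 hw.1.symm (Ne.symm hvu),
        ← GraphLabelledTree.orientedTowards_iff c.2]
      exact orientedTowards_iff_fullyAccessible_of_forall_isGood hG hu huS hunode hv hvu hc
  by_cases hf : ST.FullyAccessible (ST.leaves S) u
  · rcases isCliqueNode_or_isStarNode hG hDH hunode with hc | ⟨c, hc⟩
    · obtain ⟨w, hw, -⟩ := GraphLabelledTree.exists_ne_hitNeighbors_of_mem_span huS hnS u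
      exact ⟨w, hw, fun c hc' => absurd hc' (not_isStarNode_of_isCliqueNode hc c)⟩
    · exact ⟨c, hf.2 c c.2, fun c' hc' => by simp [hf, centre_unique hc hc']⟩
  · have hs : ST.SinglyAccessible (ST.leaves S) u := by
      by_contra hs
      exact hnp ⟨⟨hunode, huS⟩, hf, hs⟩
    obtain ⟨-, c, hc, -, -⟩ := hs
    obtain ⟨w, hw, hwc⟩ := GraphLabelledTree.exists_ne_hitNeighbors_of_mem_span huS hnS c
    exact ⟨w, hw, fun c' hc' => by simp [hf, ← centre_unique hc hc', hwc]⟩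

/-- If no node of `T(S)` on the side of `a` is partially accessible and its star nodes are
oriented towards `b` exactly if they are fully accessible, this side is good. Induction from `a`
outwards: the branches at `a` that meet `S` are those whose marker is adjacent to the marker
towards `b`. -/
theorem inter_side_eq_frontier [Finite N] (hG : G.Connected) (hDH : HasShortcuts G) {a b : N}
    (hab : ST.tree.Adj a b) (ha : (S ∩ ST.side b a).Nonempty) (hb : (S ∩ ST.side a b).Nonempty)
    (hv : ∀ v ∈ ST.branch b a, ST.IsNodeOfSpan (ST.leaves S) v →
      ¬ ST.PartiallyAccessible (ST.leaves S) v ∧ ∀ c : ST.tree.neighborSet v, ST.IsStarNode v c →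
        (b ∈ ST.branch v c ↔ ST.FullyAccessible (ST.leaves S) v)) :
    S ∩ ST.side b a = ST.frontier b a := by
  induction hn : (ST.branch b a).ncard using Nat.strong_induction_on generalizing a b with
  | _ n ih =>
    subst hn
    by_cases hleaf : ST.IsLeaf a
    · exact (isGood_of_isLeaf hab hleaf).eq_frontier ha
    have hbhit : b ∈ ST.hitNeighbors (ST.leaves S) a := mem_hitNeighbors_iff.2 ⟨hab, hb⟩
    have hspan : ST.IsNodeOfSpan (ST.leaves S) a := by
      obtain ⟨x, hxS, hx⟩ := ha
      obtain ⟨w, hw, hwb, hxw⟩ := exists_mem_side_of_mem_side hab hleaf hx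
      exact ⟨hleaf, GraphLabelledTree.mem_span_of_hitNeighbors
        (mem_hitNeighbors_iff.2 ⟨hw, x, hxS, hxw⟩) hbhit hwb⟩
    obtain ⟨hnp, hor⟩ := hv a (GraphLabelledTree.self_mem_branch hab.symm) hspan
    have hfs : ST.FullyAccessible (ST.leaves S) a ∨ ST.SinglyAccessible (ST.leaves S) a := by
      by_contra! h
      exact hnp ⟨hspan, h⟩
    have hhit : ∀ w, ST.tree.Adj a w → w ≠ b →
        (w ∈ ST.hitNeighbors (ST.leaves S) a ↔ ST.MarkersAdj a w b) := by
      intro w hw hwb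
      rcases isCliqueNode_or_isStarNode hG hDH hleaf with hc | ⟨c, hc⟩
      · have hf : ST.FullyAccessible (ST.leaves S) a :=
          hfs.resolve_right fun ⟨_, c, hs, _⟩ => not_isStarNode_of_isCliqueNode hc c hs
        exact iff_of_true (hf.2 w hw) (markersAdj_of_isCliqueNode hc hw hab hwb)
      · rw [markersAdj_iff_of_isStarNode hc hw hab hwb]
        have hbc : b ∈ ST.branch a c ↔ b = c := ⟨fun h => GraphLabelledTree.eq_of_mem_branch hab
          c.2 (GraphLabelledTree.self_mem_branch hab) h,
          fun h => h ▸ GraphLabelledTree.self_mem_branch hab⟩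
        have hor := hor c hc
        rw [hbc] at hor
        by_cases h : b = c
        · exact iff_of_true ((hor.1 h).2 w hw) (Or.inr h)
        · obtain ⟨-, c', hc', hcard, hchit⟩ := hfs.resolve_left fun hf => h (hor.2 hf)
          obtain rfl := centre_unique hc hc'
          have hpair : {b, (c : N)} = ST.hitNeighbors (ST.leaves S) a :=
            Set.eq_of_subset_of_ncard_le (by rintro _ (rfl | rfl) <;> assumption)
              (by rw [hcard, Set.ncard_pair h])
          rw [← hpair]
          simp [hwb, h]
    ext x
    by_cases hx : x ∈ ST.side b a
    swap
    · exact iff_of_false (fun h => hx h.2) (fun h => hx h.1)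
    obtain ⟨w, hw, hwb, hxw⟩ := exists_mem_side_of_mem_side hab hleaf hx
    rw [mem_frontier_iff hab hw hwb hxw, ← hhit w hw hwb]
    by_cases hwhit : w ∈ ST.hitNeighbors (ST.leaves S) a
    · have hrec := ih _ (ncard_branch_lt hab.symm hw hwb) hw.symm (mem_hitNeighbors_iff.1 hwhit).2
        (hb.mono (Set.inter_subset_inter_right S fun _ hx =>
          GraphLabelledTree.branch_subset hw hab hwb.symm hx)) (fun v hva hvS => ?_) rfl
      · rw [← hrec]
        simp [hx, hxw, hwhit]
      · have hvb := GraphLabelledTree.branch_subset hab hw hwb hva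
        have hva' : a ≠ v := by
          rintro rfl
          exact GraphLabelledTree.notMem_branch a w hva
        have hvb' : b ≠ v := by
          rintro rfl
          exact GraphLabelledTree.notMem_branch b a hvb
        refine ⟨(hv v hvb hvS).1, fun c hc => ?_⟩
        rw [← (hv v hvb hvS).2 c hc]
        exact ⟨fun h => GraphLabelledTree.mem_branch_of_adj h hab hvb',
          fun h => GraphLabelledTree.mem_branch_of_adj h hab.symm hva'⟩
    · exact iff_of_false (fun h => hwhit (mem_hitNeighbors_iff.2 ⟨hw, x, h.1, hxw⟩))
        fun h => hwhit h.2

theorem inter_side_nonempty_of_mem_span {a b : N} (hab : ST.tree.Adj a b)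
    (hb : b ∈ ST.span (ST.leaves S)) : (S ∩ ST.side a b).Nonempty := by
  by_cases hbS : b ∈ ST.leaves S
  · obtain ⟨x, hx, rfl⟩ := hbS
    exact ⟨x, hx, GraphLabelledTree.self_mem_branch hab⟩
  · obtain ⟨w, hw, hwa⟩ := GraphLabelledTree.exists_ne_hitNeighbors_of_mem_span hb hbS a
    obtain ⟨hw, x, hxS, hx⟩ := mem_hitNeighbors_iff.1 hw
    exact ⟨x, hxS, GraphLabelledTree.branch_subset hab.symm hw hwa hx⟩

/-- A branch contained in a good branch is good. -/
theorem isGood_of_inter_side_eq_frontier {a b w : N} (hab : ST.tree.Adj a b)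
    (h : S ∩ ST.side b a = ST.frontier b a) (hw : ST.tree.Adj a w) (hwb : w ≠ b) :
    ST.IsGood S a w := by
  have hsub : ST.side a w ⊆ ST.side b a := fun _ hx =>
    GraphLabelledTree.branch_subset hab hw hwb hx
  have hS : ∀ x ∈ ST.side a w, (x ∈ S ↔ x ∈ ST.frontier a w ∧ ST.MarkersAdj a w b) := by
    intro x hx
    rw [← mem_frontier_iff hab hw hwb hx, ← h]
    exact (and_iff_left (hsub hx)).symm
  by_cases hm : ST.MarkersAdj a w b
  · refine Or.inr (Set.ext fun x => ⟨fun hx => ((hS x hx.2).1 hx.1).1, fun hx => ?_⟩)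
    exact ⟨(hS x hx.1).2 ⟨hx, hm⟩, hx.1⟩
  · exact Or.inl (Set.eq_empty_of_forall_notMem fun x hx => hm ((hS x hx.2).1 hx.1).2)

end SplitTree

/-! ### The vertex incremental characterization -/

theorem mainTheorem1 {V N : Type*} [Finite V] [Finite N] (G : SimpleGraph V)
    (hconn : G.Connected) (hDH : IsDistanceHereditary G) (ST : SplitTree G N)
    (S : Set V) (hS : S.Nontrivial) :
    IsDistanceHereditary (addVertex G S) ↔
      -- at most one node of `T(S)` is partially accessible
      (∀ u v : N, ST.PartiallyAccessible (ST.leaves S) u →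
        ST.PartiallyAccessible (ST.leaves S) v → u = v) ∧
      -- every clique node of `T(S)` is fully or partially accessible
      (∀ v : N, ST.IsNodeOfSpan (ST.leaves S) v → ST.IsCliqueNode v →
        ST.FullyAccessible (ST.leaves S) v ∨ ST.PartiallyAccessible (ST.leaves S) v) ∧
      -- if `u` is partially accessible, the other star nodes of `T(S)` are oriented towards `u`
      -- exactly when they are fully accessible
      (∀ u : N, ST.PartiallyAccessible (ST.leaves S) u →
        ∀ (v : N) (c : ST.tree.neighborSet v), v ≠ u → ST.IsNodeOfSpan (ST.leaves S) v →
          ST.IsStarNode v c →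
          (ST.OrientedTowards v c u ↔ ST.FullyAccessible (ST.leaves S) v)) ∧
      -- otherwise some tree-edge `ab` of `T(S)` plays this role for all star nodes of `T(S)`
      ((¬ ∃ u : N, ST.PartiallyAccessible (ST.leaves S) u) →
        ∃ a b : N, ST.tree.Adj a b ∧ a ∈ ST.span (ST.leaves S) ∧ b ∈ ST.span (ST.leaves S) ∧
          ∀ (v : N) (c : ST.tree.neighborSet v), ST.IsNodeOfSpan (ST.leaves S) v →
            ST.IsStarNode v c →
            (ST.OrientedTowardsEdge v c a b ↔ ST.FullyAccessible (ST.leaves S) v)) := by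
  have hG := hDH.hasShortcuts
  constructor
  · intro h
    rcases SplitTree.exists_forall_isGood (ST := ST) hconn hG h.hasShortcuts hS with
      ⟨u, hnode, hu, w, hw, w', hw', hne⟩ | ⟨a, b, hab, ha, hb⟩
    · have huS := GraphLabelledTree.mem_span_of_hitNeighbors hw hw' hne
      have hunique : ∀ v, ST.PartiallyAccessible (ST.leaves S) v → v = u := fun v hv => by
        by_contra hvu
        exact SplitTree.not_partiallyAccessible_of_forall_isGood hconn hG hu huS hnode hvu hv
      refine ⟨fun v v' hv hv' => (hunique v hv).trans (hunique v' hv').symm,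
        fun v => SplitTree.fullyAccessible_or_partiallyAccessible_of_isCliqueNode,
        fun u' hu' v c hvu hv hc => ?_, fun hno => ?_⟩
      · obtain rfl := hunique u' hu'
        exact SplitTree.orientedTowards_iff_fullyAccessible_of_forall_isGood hconn hu huS hnode hv
          hvu hc
      · exact SplitTree.exists_edge_of_forall_isGood hconn hG hu huS hnode fun h => hno ⟨u, h⟩
    · -- the tree has no node: it consists of the two leaves `a` and `b`
      have hall : ∀ v, v = a ∨ v = b := fun v => by
        by_cases hv : v ∈ ST.branch a b
        · exact Or.inr (GraphLabelledTree.eq_of_isLeaf_of_mem_branch hab.symm hb hv)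
        · exact Or.inl (GraphLabelledTree.eq_of_isLeaf_of_mem_branch hab ha
            (GraphLabelledTree.mem_branch_of_notMem_branch hab hv))
      have hnode : ∀ v, ¬ ST.IsNode v := fun v hv => by
        rcases hall v with rfl | rfl
        · exact hv ha
        · exact hv hb
      have hmem : a ∈ ST.leaves S ∧ b ∈ ST.leaves S := by
        obtain ⟨x, hx, y, hy, hxy⟩ := hS
        have hne : ST.vert x ≠ ST.vert y := fun h => hxy (SplitTree.vert_injective h)
        have hx' : ST.vert x ∈ ST.leaves S := ⟨x, hx, rfl⟩
        have hy' : ST.vert y ∈ ST.leaves S := ⟨y, hy, rfl⟩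
        rcases hall (ST.vert x) with h1 | h1 <;> rcases hall (ST.vert y) with h2 | h2 <;>
          simp_all
      exact ⟨fun u _ hu _ => absurd hu.1.1 (hnode u), fun v hv _ => absurd hv.1 (hnode v),
        fun u hu => absurd hu.1.1 (hnode u), fun _ => ⟨a, b, hab,
          GraphLabelledTree.subset_span _ hmem.1, GraphLabelledTree.subset_span _ hmem.2,
          fun v _ hv => absurd hv.1 (hnode v)⟩⟩
  · rintro ⟨h1, -, h3, h4⟩
    apply HasShortcuts.isDistanceHereditary
    by_cases hp : ∃ u, ST.PartiallyAccessible (ST.leaves S) u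
    · obtain ⟨u, hu⟩ := hp
      refine SplitTree.addVertex_hasShortcuts_of_forall_isGood (ST := ST) hconn hG (u := u)
        fun w hw => ?_
      by_cases hwS : (S ∩ ST.side u w).Nonempty
      · refine Or.inr (SplitTree.inter_side_eq_frontier hconn hG hw.symm hwS
          (SplitTree.inter_side_nonempty_of_mem_span hw.symm hu.1.2) fun v hv hvS => ?_)
        have hvu : v ≠ u := by
          rintro rfl
          exact GraphLabelledTree.notMem_branch v w hv
        refine ⟨fun hvp => hvu (h1 v u hvp hu), fun c hc => ?_⟩
        rw [← h3 u hu v c hvu hvS hc, GraphLabelledTree.orientedTowards_iff c.2]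
      · exact Or.inl (Set.not_nonempty_iff_eq_empty.1 hwS)
    · obtain ⟨a, b, hab, ha, hb, hor⟩ := h4 hp
      have haS := SplitTree.inter_side_nonempty_of_mem_span hab.symm ha
      have hbS := SplitTree.inter_side_nonempty_of_mem_span hab hb
      have hA : S ∩ ST.side b a = ST.frontier b a := by
        refine SplitTree.inter_side_eq_frontier hconn hG hab haS hbS fun v hv hvS =>
          ⟨fun hvp => hp ⟨v, hvp⟩, fun c hc => ?_⟩
        have hvb : b ≠ v := by
          rintro rfl
          exact GraphLabelledTree.notMem_branch b a hv
        rw [← hor v c hvS hc, GraphLabelledTree.orientedTowardsEdge_iff c.2 hab hvb]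
      have hB : S ∩ ST.side a b = ST.frontier a b := by
        refine SplitTree.inter_side_eq_frontier hconn hG hab.symm hbS haS fun v hv hvS =>
          ⟨fun hvp => hp ⟨v, hvp⟩, fun c hc => ?_⟩
        have hva : a ≠ v := by
          rintro rfl
          exact GraphLabelledTree.notMem_branch a b hv
        rw [← hor v c hvS hc, ← GraphLabelledTree.orientedTowardsEdge_iff c.2 hab.symm hva]
        exact or_comm
      refine SplitTree.addVertex_hasShortcuts_of_forall_isGood (ST := ST) hconn hG (u := a)
        fun w hw => ?_
      by_cases hwb : w = b
      · exact Or.inr (hwb ▸ hB)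
      · exact SplitTree.isGood_of_inter_side_eq_frontier hab hA hw hwb
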